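/- Let $\Gamma$ be a group with a finite generating set $S$ and associated word length $|\cdot|$, acting simplicially and freely on a contractible simplicial complex $X$ such that, for some $d\ge 1$, the $(d+1)$-skeleton of $X$ is cocompact (finitely many orbits of simplices of dimension $\le d+1$). For $j\ge 2$ and $t\in\mathbb N$ let $$\mathrm{cFV}^j_X(t)=\sup\Big\{\min\{\|b\|_1 : b\in C_j(X,\mathbb Z),\ \partial b=c\} \;:\; c\in C_{j-1}(X,\mathbb Z),\ \partial c=0,\ \|c\|_1\le t\Big\}$$ be the combinatorial filling functions of $X$, where $C_*(X,\mathbb Z)$ are the integral simplicial chains with the $\ell^1$-norm $\|\sum a_\sigma\sigma\|_1=\sum|a_\sigma|$. Write $f\lesssim g$ if there is $C>0$ with $f(n)\le C\,g(Cn+C)+Cn+C$ for all $n>0$, and $f\sim g$ if $f\lesssim g\lesssim f$; $f$ is polynomially bounded if $f\lesssim t^a$ for some $a\ge 0$, polynomial if $f\sim t^a$ for some $a>0$, and $\deg f=\inf\{a\ge 1: f\lesssim t^a\}$. Suppose that $\mathrm{cFV}^j_X$ is polynomially bounded for $2\le j\le d+1$. For $k\ge 1$ and $N\in\mathbb R$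 set $$N_k=\prod_{j=2}^k\deg \mathrm{cFV}^j_X\quad(\text{so } N_1=1),\qquad \alpha_1(N)=N+1,$$ $$\alpha_i(N)=\max\Big\{(N+1)\prod_{j=2}^i\deg \mathrm{cFV}^j_X,\ \prod_{j=2}^i\deg \mathrm{cFV}^j_X+\alpha_{i-1}(N)\Big\}\quad (i\ge 2).$$ Let $(\rho,V)$ be a linear isometric representation of $\Gamma$ on a real or complex Banach space. Let $C^k(\Gamma,V)^\Gamma$ be the space of maps $c:\Gamma^{k+1}\to V$ with $c(\gamma\gamma_0,\dots,\gamma\gamma_k)=\rho(\gamma)c(\gamma_0,\dots,\gamma_k)$, with the topology of pointwise convergence and the usual coboundary operator $d$, and let $C^k_{\mathrm{pol}\le N}(\Gamma,V)^\Gamma$ be the subspace of those $c$ for which there is a constant $C$ with $\|c(\gamma_0,\dots,\gamma_k)\|\le C(1+|\gamma_0|+\dots+|\gamma_k|)^N$ for all $\gamma_0,\dots,\gamma_k$. Let $Z^k$ and $B^k$ be the cocycles and coboundaries in $C^k(\Gamma,V)^\Gamma$, let $Z^k_{\mathrm{pol}\le N}=Z^k\cap C^k_{\mathrm{pol}\le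 N}(\Gamma,V)^\Gamma$ and, for $M\ge N$, $B^k_{\mathrm{pol}:M\to N}=d\big(C^{k-1}_{\mathrm{pol}\le M}(\Gamma,V)^\Gamma\big)\cap C^k_{\mathrm{pol}\le N}(\Gamma,V)^\Gamma$. Let $H^k(\Gamma,V)=Z^k/B^k$ and $H^k_{\mathrm{pol}:M\to N}(\Gamma,V)=Z^k_{\mathrm{pol}\le N}/B^k_{\mathrm{pol}:M\to N}$, and let the reduced versions be the quotients of $Z^k$ and $Z^k_{\mathrm{pol}\le N}$ by the closures of $B^k$ in $Z^k$ and of $B^k_{\mathrm{pol}:M\to N}$ in $Z^k_{\mathrm{pol}\le N}$; all carry the quotient topologies. The inclusion of cochains induces comparison maps $$H^k_{\mathrm{pol}:M\to N}(\Gamma,V)\to H^k(\Gamma,V),\qquad \overline H^k_{\mathrm{pol}:M\to N}(\Gamma,V)\to\overline H^k(\Gamma,V).$$ Then for every $1\le k\le d$: 1. for all $N>N_k$ and $M\ge N$, both comparison maps are surjective; 2. for all $N>N_k$ and $M\ge N$ such that $M>\alpha_{k-1}(N)$ (for $k=1$ this last condition is empty), both comparison maps are isomorphisms of topological vector spaces;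 3. if moreover the functions $\mathrm{cFV}^j_X$ are polynomial for $2\le j\le k$, then both comparison maps are surjective for $N=N_k$ and all $M\ge N_k$, and both are isomorphisms of topological vector spaces for $N=N_k$ and $M=\alpha_{k-1}(N_k)$ (for $k=1$: for $N=N_1=1$ and all $M\ge 1$). -/

import Mathlib

open scoped ENNReal NNReal Topology

noncomputable section

namespace PolCohomology

/-! ### Simplicial complexes, their realization, and simplicial actions -/

section Complexes

variable {ι : Type*}

/-- The geometric realization of an abstract simplicial complex: finitely supported barycentric
coordinates whose support is a simplex. -/
def Realization (X : AbstractSimplicialComplex ι) : Type _ :=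
  {x : ι →₀ ℝ // x.support ∈ X.faces ∧ (∀ v, 0 ≤ x v) ∧ (x.sum fun _ a => a) = 1}

/-- The closed simplex of the realization spanned by the vertices in `s`. -/
def ClosedSimplex (X : AbstractSimplicialComplex ι) (s : Finset ι) : Type _ :=
  {x : Realization X // x.1.support ⊆ s}

/-- The Euclidean topology of a closed simplex, given by the barycentric coordinates. -/
instance (X : AbstractSimplicialComplex ι) (s : Finset ι) : TopologicalSpace (ClosedSimplex X s) :=
  TopologicalSpace.induced (fun x (v : ι) => x.1.1 v) inferInstance

/-- The inclusion of a closed simplex into the realization. -/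
def ClosedSimplex.incl (X : AbstractSimplicialComplex ι) (s : Finset ι) :
    ClosedSimplex X s → Realization X :=
  fun x => x.1

/-- The weak topology of the realization: a set is open if and only if its trace on every closed
simplex is open. -/
instance (X : AbstractSimplicialComplex ι) : TopologicalSpace (Realization X) :=
  ⨆ s ∈ X.faces, TopologicalSpace.coinduced (ClosedSimplex.incl X s) inferInstance

/-- The translate `g • s` of a finite set of vertices. -/
def translate {Γ : Type*} [Group Γ] [MulAction Γ ι] (g : Γ) (s : Finset ι) : Finset ι :=
  s.map (MulAction.toPerm g).toEmbedding

/-- The action of `Γ` on the vertices is an action on the simplicial complex `X`. -/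
def IsSimplicialAction (Γ : Type*) [Group Γ] [MulAction Γ ι]
    (X : AbstractSimplicialComplex ι) : Prop :=
  ∀ (g : Γ), ∀ s ∈ X.faces, translate g s ∈ X.faces

/-- The action of `Γ` on `X` (i.e. on its realization) is free: no nontrivial element maps a simplex
to itself. -/
def IsFreeAction (Γ : Type*) [Group Γ] [MulAction Γ ι]
    (X : AbstractSimplicialComplex ι) : Prop :=
  ∀ (g : Γ), ∀ s ∈ X.faces, translate g s = s → g = 1

/-- The `n`-skeleton of `X` is cocompact: there are finitely many orbits of simplices of dimension
at most `n`. -/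
def HasCocompactSkeleton (Γ : Type*) [Group Γ] [MulAction Γ ι]
    (X : AbstractSimplicialComplex ι) (n : ℕ) : Prop :=
  ∃ T : Set (Finset ι), T.Finite ∧
    ∀ s ∈ X.faces, s.card ≤ n + 1 → ∃ t ∈ T, ∃ g : Γ, s = translate g t

/-! ### Integral simplicial chains and combinatorial filling functions -/

/-- The group `C_n(X, ℤ)` of integral simplicial `n`-chains. A chain is represented by its
coefficients: `c (v₀, …, vₙ)` is the coefficient of the oriented simplex `[v₀, …, vₙ]`, so that `c`
is supported on the orderings of `n`-simplices of `X` and is alternating. -/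
def simplicialChains (X : AbstractSimplicialComplex ι) (n : ℕ) :
    AddSubgroup ((Fin (n + 1) → ι) →₀ ℤ) where
  carrier := {c | (∀ τ, c τ ≠ 0 → Function.Injective τ ∧ ∃ s ∈ X.faces, (s : Set ι) = Set.range τ) ∧
    ∀ (σ : Equiv.Perm (Fin (n + 1))) (τ : Fin (n + 1) → ι),
      c (τ ∘ σ) = (Equiv.Perm.sign σ : ℤ) * c τ}
  zero_mem' := by simp
  add_mem' := by
    rintro a b ⟨ha, ha'⟩ ⟨hb, hb'⟩
    refine ⟨fun τ h => ?_, fun σ τ => ?_⟩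
    · by_cases h0 : a τ = 0
      · exact hb τ (by simpa [h0] using h)
      · exact ha τ h0
    · rw [Finsupp.add_apply, Finsupp.add_apply, ha', hb', mul_add]
  neg_mem' := by
    rintro a ⟨ha, ha'⟩
    refine ⟨fun τ h => ha τ (by simpa using h), fun σ τ => ?_⟩
    rw [Finsupp.neg_apply, Finsupp.neg_apply, ha', mul_neg]

/-- The simplicial boundary operator: `(∂c)(τ) = ∑ v, c (v, τ)`. This is the usual formula
`∂[v₀, …, vₙ₊₁] = ∑ᵢ (-1)ⁱ [v₀, …, v̂ᵢ, …, vₙ₊₁]`, since the coefficient of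
`[v₀, …, v̂ᵢ, …, vₙ₊₁]` in the left-hand side is that of `[vᵢ, v₀, …, v̂ᵢ, …, vₙ₊₁]`
in `[v₀, …, vₙ₊₁]`, i.e. `(-1)ⁱ`. -/
def boundary {n : ℕ} : ((Fin (n + 2) → ι) →₀ ℤ) →+ ((Fin (n + 1) → ι) →₀ ℤ) :=
  Finsupp.mapDomain.addMonoidHom Fin.tail

/-- The `ℓ¹`-norm `∑_σ |a_σ|` of a chain, the sum being over the (unordered) `n`-simplices: every
simplex has `(n + 1)!` orderings, which all have the same absolute value. -/
def l1Norm {n : ℕ} (c : (Fin (n + 1) → ι) →₀ ℤ) : ℝ≥0∞ :=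
  ((∑ τ ∈ c.support, (c τ).natAbs : ℕ) : ℝ≥0∞) / (Nat.factorial (n + 1) : ℝ≥0∞)

/-- The filling volume of an `n`-chain: the minimal norm of an `(n + 1)`-chain with boundary `c`
(`∞` if there is none). -/
def fillingVolume (X : AbstractSimplicialComplex ι) {n : ℕ} (c : (Fin (n + 1) → ι) →₀ ℤ) : ℝ≥0∞ :=
  ⨅ b : (Fin (n + 2) → ι) →₀ ℤ, ⨅ _ : b ∈ simplicialChains X (n + 1) ∧ boundary b = c, l1Norm b

/-- The combinatorial filling function `cFV^k_X`, for `k ≥ 2` (and by convention `0` for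
`k = 0, 1`, where it is not used): the supremum of the filling volumes of the integral
`(k - 1)`-cycles of norm at most `t`. -/
def cFV (X : AbstractSimplicialComplex ι) : ℕ → ℕ → ℝ≥0∞
  | n + 2, t => ⨆ c : (Fin (n + 2) → ι) →₀ ℤ,
      ⨆ _ : c ∈ simplicialChains X (n + 1) ∧ boundary c = 0 ∧ l1Norm c ≤ (t : ℝ≥0∞),
        fillingVolume X c
  | _, _ => 0

end Complexes

/-! ### Growth of functions -/

/-- `f ≲ g`: there is `C > 0` with `f n ≤ C g(Cn + C) + Cn + C` for all `n > 0`. -/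
def AsympLE (f g : ℕ → ℝ≥0∞) : Prop :=
  ∃ C : ℕ, 0 < C ∧ ∀ n : ℕ, 0 < n → f n ≤ C * g (C * n + C) + C * n + C

/-- The function `t ↦ t ^ a`. -/
def powerFun (a : ℝ) (n : ℕ) : ℝ≥0∞ := ENNReal.ofReal ((n : ℝ) ^ a)

/-- `f` is polynomially bounded: `f ≲ t ^ a` for some `a ≥ 0`. -/
def PolynomiallyBounded (f : ℕ → ℝ≥0∞) : Prop :=
  ∃ a : ℝ, 0 ≤ a ∧ AsympLE f (powerFun a)

/-- `f` is polynomial: `f ∼ t ^ a` for some `a > 0`. -/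
def IsPolynomial (f : ℕ → ℝ≥0∞) : Prop :=
  ∃ a : ℝ, 0 < a ∧ AsympLE f (powerFun a) ∧ AsympLE (powerFun a) f

/-- The degree of a polynomially bounded function: the infimum of the exponents `a ≥ 1` with
`f ≲ t ^ a` (exponents below `1` cannot be distinguished from `1` by the relation `≲`). -/
def growthDegree (f : ℕ → ℝ≥0∞) : ℝ :=
  sInf {a : ℝ | 1 ≤ a ∧ AsympLE f (powerFun a)}

section Constants

variable {ι : Type*} (X : AbstractSimplicialComplex ι)

/-- `N_k = ∏_{j = 2}^k deg cFV^j`; in particular `N_1 = 1`. -/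
def Nconst (k : ℕ) : ℝ := ∏ j ∈ Finset.Icc 2 k, growthDegree (cFV X j)

/-- The functions `α_i`, for `i ≥ 1` (the value at `i = 0` is a convention and is not used). -/
def alpha (N : ℝ) : ℕ → ℝ
  | 0 => N
  | 1 => N + 1
  | i + 2 => max ((N + 1) * ∏ j ∈ Finset.Icc 2 (i + 2), growthDegree (cFV X j))
      ((∏ j ∈ Finset.Icc 2 (i + 2), growthDegree (cFV X j)) + alpha N (i + 1))

end Constants

/-! ### Group cohomology and quantitative polynomial cohomology -/

section Cohomology

variable {Γ : Type*} [Group Γ]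

/-- The word length of `γ` with respect to `S`: the least length of a word in `S ∪ S⁻¹`
representing `γ`. -/
def wordLength (S : Finset Γ) (γ : Γ) : ℕ :=
  sInf {n | ∃ l : List Γ, l.length = n ∧ (∀ x ∈ l, x ∈ S ∨ x⁻¹ ∈ S) ∧ l.prod = γ}

/-- The `k`-cochains `Γ^(k+1) → V`, with the topology of pointwise convergence. -/
abbrev Cochain (Γ V : Type*) (k : ℕ) : Type _ := (Fin (k + 1) → Γ) → V

variable {𝕜 : Type*} [RCLike 𝕜] {V : Type*} [NormedAddCommGroup V] [NormedSpace 𝕜 V]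

variable (Γ 𝕜 V) in
/-- The homogeneous coboundary operator. -/
def coboundary (k : ℕ) : Cochain Γ V k →ₗ[𝕜] Cochain Γ V (k + 1) where
  toFun c x := ∑ i : Fin (k + 2), (-1 : 𝕜) ^ (i : ℕ) • c (fun j => x (i.succAbove j))
  map_add' a b := by
    funext x
    simp [Finset.sum_add_distrib]
  map_smul' r a := by
    funext x
    simp [Finset.smul_sum, smul_comm r]

/-- The space `C^k(Γ, V)^Γ` of equivariant cochains. -/
def equivariantCochains (ρ : Γ →* (V ≃ₗᵢ[𝕜] V)) (k : ℕ) : Submodule 𝕜 (Cochain Γ V k) where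
  carrier := {c | ∀ (g : Γ) (x : Fin (k + 1) → Γ), c (fun i => g * x i) = ρ g (c x)}
  zero_mem' := by simp
  add_mem' := by
    intro a b ha hb g x
    simp [ha g x, hb g x]
  smul_mem' := by
    intro r a ha g x
    simp [ha g x]

variable (𝕜 V) in
/-- The space of cochains of polynomial growth at most `N`. -/
def polynomialCochains (S : Finset Γ) (N : ℝ) (k : ℕ) : Submodule 𝕜 (Cochain Γ V k) where
  carrier := {c | ∃ C : ℝ, ∀ x : Fin (k + 1) → Γ,
    ‖c x‖ ≤ C * (1 + ∑ i, (wordLength S (x i) : ℝ)) ^ N}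
  zero_mem' := ⟨0, by simp⟩
  add_mem' := by
    rintro a b ⟨C, hC⟩ ⟨D, hD⟩
    refine ⟨C + D, fun x => (norm_add_le _ _).trans ?_⟩
    rw [add_mul]
    exact add_le_add (hC x) (hD x)
  smul_mem' := by
    rintro r a ⟨C, hC⟩
    refine ⟨‖r‖ * C, fun x => ?_⟩
    rw [Pi.smul_apply, norm_smul, mul_assoc]
    exact mul_le_mul_of_nonneg_left (hC x) (norm_nonneg r)

/-- The space `C^k_{pol ≤ N}(Γ, V)^Γ`. -/
def polEquivariantCochains (ρ : Γ →* (V ≃ₗᵢ[𝕜] V)) (S : Finset Γ) (N : ℝ) (k : ℕ) :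
    Submodule 𝕜 (Cochain Γ V k) :=
  equivariantCochains ρ k ⊓ polynomialCochains 𝕜 V S N k

/-- The cocycles `Z^k(Γ, V)`. -/
def cocycles (ρ : Γ →* (V ≃ₗᵢ[𝕜] V)) (k : ℕ) : Submodule 𝕜 (Cochain Γ V k) :=
  equivariantCochains ρ k ⊓ LinearMap.ker (coboundary Γ 𝕜 V k)

/-- The coboundaries `B^k(Γ, V)`. -/
def coboundaries (ρ : Γ →* (V ≃ₗᵢ[𝕜] V)) : (k : ℕ) → Submodule 𝕜 (Cochain Γ V k)
  | 0 => ⊥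
  | k + 1 => (equivariantCochains ρ k).map (coboundary Γ 𝕜 V k)

/-- The cocycles `Z^k_{pol ≤ N}(Γ, V)`. -/
def polCocycles (ρ : Γ →* (V ≃ₗᵢ[𝕜] V)) (S : Finset Γ) (N : ℝ) (k : ℕ) :
    Submodule 𝕜 (Cochain Γ V k) :=
  polEquivariantCochains ρ S N k ⊓ LinearMap.ker (coboundary Γ 𝕜 V k)

/-- The coboundaries `B^k_{pol : M → N}(Γ, V)`. -/
def polCoboundaries (ρ : Γ →* (V ≃ₗᵢ[𝕜] V)) (S : Finset Γ) (M N : ℝ) :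
    (k : ℕ) → Submodule 𝕜 (Cochain Γ V k)
  | 0 => ⊥
  | k + 1 => (polEquivariantCochains ρ S M k).map (coboundary Γ 𝕜 V k) ⊓
      polEquivariantCochains ρ S N (k + 1)

/-- The group cohomology `H^k(Γ, V)`, with the quotient topology. -/
abbrev H (ρ : Γ →* (V ≃ₗᵢ[𝕜] V)) (k : ℕ) : Type _ :=
  cocycles ρ k ⧸ (coboundaries ρ k).submoduleOf (cocycles ρ k)

/-- The reduced group cohomology. -/
abbrev Hred (ρ : Γ →* (V ≃ₗᵢ[𝕜] V)) (k : ℕ) : Type _ :=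
  cocycles ρ k ⧸ ((coboundaries ρ k).submoduleOf (cocycles ρ k)).topologicalClosure

/-- The quantitative polynomial cohomology `H^k_{pol : M → N}(Γ, V)`, with the quotient
topology. -/
abbrev Hpol (ρ : Γ →* (V ≃ₗᵢ[𝕜] V)) (S : Finset Γ) (M N : ℝ) (k : ℕ) : Type _ :=
  polCocycles ρ S N k ⧸ (polCoboundaries ρ S M N k).submoduleOf (polCocycles ρ S N k)

/-- The reduced quantitative polynomial cohomology; the closure of the coboundaries is taken inside
the polynomial cocycles. -/
abbrev HpolRed (ρ : Γ →* (V ≃ₗᵢ[𝕜] V)) (S : Finset Γ) (M N : ℝ) (k : ℕ) : Type _ :=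
  polCocycles ρ S N k ⧸
    ((polCoboundaries ρ S M N k).submoduleOf (polCocycles ρ S N k)).topologicalClosure

theorem polCocycles_le (ρ : Γ →* (V ≃ₗᵢ[𝕜] V)) (S : Finset Γ) (N : ℝ) (k : ℕ) :
    polCocycles ρ S N k ≤ cocycles ρ k :=
  inf_le_inf_right _ inf_le_left

theorem polCoboundaries_le (ρ : Γ →* (V ≃ₗᵢ[𝕜] V)) (S : Finset Γ) (M N : ℝ) (k : ℕ) :
    polCoboundaries ρ S M N k ≤ coboundaries ρ k := by
  cases k with
  | zero => exact le_rfl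
  | succ k => exact inf_le_left.trans (Submodule.map_mono inf_le_left)

/-- The inclusion of polynomial cocycles into cocycles. -/
def cocycleInclusion (ρ : Γ →* (V ≃ₗᵢ[𝕜] V)) (S : Finset Γ) (N : ℝ) (k : ℕ) :
    polCocycles ρ S N k →ₗ[𝕜] cocycles ρ k :=
  Submodule.inclusion (polCocycles_le ρ S N k)

theorem submoduleOf_le_comap (ρ : Γ →* (V ≃ₗᵢ[𝕜] V)) (S : Finset Γ) (M N : ℝ) (k : ℕ) :
    (polCoboundaries ρ S M N k).submoduleOf (polCocycles ρ S N k) ≤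
      ((coboundaries ρ k).submoduleOf (cocycles ρ k)).comap (cocycleInclusion ρ S N k) :=
  fun _ hx => polCoboundaries_le ρ S M N k hx

theorem closure_le_comap (ρ : Γ →* (V ≃ₗᵢ[𝕜] V)) (S : Finset Γ) (M N : ℝ) (k : ℕ) :
    ((polCoboundaries ρ S M N k).submoduleOf (polCocycles ρ S N k)).topologicalClosure ≤
      ((coboundaries ρ k).submoduleOf (cocycles ρ k)).topologicalClosure.comap
        (cocycleInclusion ρ S N k) := by
  refine Submodule.topologicalClosure_minimal _ ?_ ?_
  · exact (submoduleOf_le_comap ρ S M N k).trans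
      (Submodule.comap_mono (Submodule.le_topologicalClosure _))
  · have hc : Continuous (cocycleInclusion ρ S N k) :=
      Continuous.subtype_mk continuous_subtype_val _
    exact (Submodule.isClosed_topologicalClosure _).preimage hc

/-- The comparison map `H^k_{pol : M → N}(Γ, V) → H^k(Γ, V)`. -/
def comparison (ρ : Γ →* (V ≃ₗᵢ[𝕜] V)) (S : Finset Γ) (M N : ℝ) (k : ℕ) :
    Hpol ρ S M N k →ₗ[𝕜] H ρ k :=
  Submodule.mapQ _ _ (cocycleInclusion ρ S N k) (submoduleOf_le_comap ρ S M N k)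

/-- The comparison map in reduced cohomology. -/
def comparisonRed (ρ : Γ →* (V ≃ₗᵢ[𝕜] V)) (S : Finset Γ) (M N : ℝ) (k : ℕ) :
    HpolRed ρ S M N k →ₗ[𝕜] Hred ρ k :=
  Submodule.mapQ _ _ (cocycleInclusion ρ S N k) (closure_le_comap ρ S M N k)

end Cohomology

end PolCohomology

end

open PolCohomology

/-!
The comparison maps are inverted by an explicit operator on cochains. Fix an equivariant map `g`
from the vertices of `X` to `Γ` (the action is free) and a vertex `v₀`. Filling the simplices of
`Γ` one dimension after the other by chains of minimal mass gives an equivariant chain map `fillMap`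
from the homogeneous bar complex of `Γ` to the simplicial chains of `X`, up to degree `d`; its
existence uses only that `X` is connected and that cycles in degrees `1, …, d - 1` bound, the latter
being part of the finiteness of the filling functions. The operator `fillOp` is dual to `fillMap`
followed by the map induced by `g`.

* The mass of `fillMap X v₀ k x` is at most a multiple of `(spread x) ^ A`, where `spread x` is
  essentially the diameter of `x` and `A` is the product of exponents of the filling functions of
  degrees `2, …, k` (`controlled_fillMap`). An equivariant cochain is bounded on tuples of bounded
  diameter, so `fillOp` maps every equivariant cochain to one of growth at most `A` (`fillOp_mem`).
* Minimal fillings have no component away from the cycle that they fill, so their distance to the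
  cycle is bounded by their mass (`exists_near_of_minimal`).
* Coning in the bar complex gives a homotopy `fillHomotopy` between `fillOp` and the identity
  (`altDiff_fillHomotopy`). Its value at `x` involves about `(spread x) ^ A` values of the cochain,
  at tuples of size about `(spread x) ^ A`; on cochains of growth `N` it therefore has growth
  `(N + 1) * A` (`fillHomotopy_mem`), and `(N + 1) * N_i ≤ α_i(N)` (`mul_Nconst_le_alpha`).

Hence a cocycle `z` differs from its image under `fillOp`, which has polynomial growth, by a
coboundary, and if `z` has growth `N`, by the coboundary of a cochain of growth `M`. Since `fillOp`
is continuous for pointwise convergence, it induces continuous inverses of the comparison maps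
(`comparison_isHomeomorph`). The exponents are chosen slightly above the degrees of the filling
functions (`exists_exponents`), or equal to the degrees if the functions are polynomial
(`IsPolynomial.hasFillingExponent`).
-/

noncomputable section

namespace PolCohomology

/-! ### The word length -/

section WordLength

variable {Γ : Type*} [Group Γ] (S : Finset Γ)

theorem wordLength_le_length {S : Finset Γ} {l : List Γ} (hl : ∀ x ∈ l, x ∈ S ∨ x⁻¹ ∈ S) :
    wordLength S l.prod ≤ l.length :=
  Nat.sInf_le ⟨l, rfl, hl, rfl⟩

theorem exists_word {S : Finset Γ} (hS : Subgroup.closure (S : Set Γ) = ⊤) (γ : Γ) :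
    ∃ l : List Γ, l.length = wordLength S γ ∧ (∀ x ∈ l, x ∈ S ∨ x⁻¹ ∈ S) ∧ l.prod = γ := by
  have hγ : γ ∈ (Subgroup.closure (S : Set Γ)).toSubmonoid := by rw [hS]; trivial
  rw [Subgroup.closure_toSubmonoid] at hγ
  obtain ⟨l, hl, hp⟩ := Submonoid.exists_list_of_mem_closure hγ
  exact Nat.sInf_mem (s := {n | ∃ l : List Γ, l.length = n ∧
    (∀ x ∈ l, x ∈ S ∨ x⁻¹ ∈ S) ∧ l.prod = γ}) ⟨_, l, rfl, hl, hp⟩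

@[simp]
theorem wordLength_one : wordLength S (1 : Γ) = 0 :=
  Nat.le_zero.1 (wordLength_le_length (S := S) (l := []) (by simp))

variable {S}

theorem wordLength_mul_le (hS : Subgroup.closure (S : Set Γ) = ⊤) (a b : Γ) :
    wordLength S (a * b) ≤ wordLength S a + wordLength S b := by
  obtain ⟨l, h1, h2, rfl⟩ := exists_word hS a
  obtain ⟨m, h3, h4, rfl⟩ := exists_word hS b
  rw [← h1, ← h3, ← List.prod_append, ← List.length_append]
  exact wordLength_le_length fun x hx => (List.mem_append.1 hx).elim (h2 x) (h4 x)

theorem wordLength_inv (hS : Subgroup.closure (S : Set Γ) = ⊤) (a : Γ) :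
    wordLength S a⁻¹ = wordLength S a := by
  have key : ∀ a : Γ, wordLength S a⁻¹ ≤ wordLength S a := by
    intro a
    obtain ⟨l, h1, h2, rfl⟩ := exists_word hS a
    rw [← h1, List.prod_inv_reverse]
    refine (wordLength_le_length fun x hx => ?_).trans (by simp)
    simp only [List.mem_reverse, List.mem_map] at hx
    obtain ⟨y, hy, rfl⟩ := hx
    rw [inv_inv]
    exact (h2 y hy).symm
  exact le_antisymm (key a) (by simpa using key a⁻¹)

theorem wordLength_dist_triangle (hS : Subgroup.closure (S : Set Γ) = ⊤) (a b c : Γ) :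
    wordLength S (a⁻¹ * c) ≤ wordLength S (a⁻¹ * b) + wordLength S (b⁻¹ * c) := by
  simpa [mul_assoc] using wordLength_mul_le hS (a⁻¹ * b) (b⁻¹ * c)

theorem finite_wordLength_le (hS : Subgroup.closure (S : Set Γ) = ⊤) (n : ℕ) :
    {γ : Γ | wordLength S γ ≤ n}.Finite := by
  have hT : {x : Γ | x ∈ S ∨ x⁻¹ ∈ S}.Finite :=
    S.finite_toSet.union (S.finite_toSet.preimage inv_injective.injOn)
  have hU : Finite {x : Γ // x ∈ S ∨ x⁻¹ ∈ S} := hT.to_subtype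
  refine ((List.finite_length_le {x : Γ // x ∈ S ∨ x⁻¹ ∈ S} n).image
    fun l => (l.map Subtype.val).prod).subset fun γ hγ => ?_
  obtain ⟨l, h1, h2, rfl⟩ := exists_word hS γ
  refine ⟨l.attach.map fun x => ⟨x.1, h2 x.1 x.2⟩, ?_, ?_⟩
  · simpa [h1] using hγ
  · simp

/-- One plus the diameter of a tuple of group elements for the word metric. -/
def spread (S : Finset Γ) {k : ℕ} (x : Fin (k + 1) → Γ) : ℕ :=
  1 + Finset.univ.sup fun p : Fin (k + 1) × Fin (k + 1) => wordLength S ((x p.1)⁻¹ * x p.2)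

theorem one_le_spread {k : ℕ} (x : Fin (k + 1) → Γ) : 1 ≤ spread S x := by
  simp [spread]

theorem wordLength_dist_le_spread {k : ℕ} (x : Fin (k + 1) → Γ) (i j : Fin (k + 1)) :
    wordLength S ((x i)⁻¹ * x j) ≤ spread S x :=
  (Finset.le_sup (f := fun p : Fin (k + 1) × Fin (k + 1) => wordLength S ((x p.1)⁻¹ * x p.2))
    (Finset.mem_univ (i, j))).trans (Nat.le_add_left _ _)

theorem spread_comp_le {k l : ℕ} (x : Fin (k + 1) → Γ) (e : Fin (l + 1) → Fin (k + 1)) :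
    spread S (fun i => x (e i)) ≤ spread S x := by
  unfold spread
  gcongr
  exact Finset.sup_le fun p _ => Finset.le_sup
    (f := fun p : Fin (k + 1) × Fin (k + 1) => wordLength S ((x p.1)⁻¹ * x p.2))
    (Finset.mem_univ (e p.1, e p.2))

theorem spread_mul_left {k : ℕ} (g : Γ) (x : Fin (k + 1) → Γ) :
    spread S (fun i => g * x i) = spread S x := by
  simp [spread, mul_assoc]

theorem spread_le (hS : Subgroup.closure (S : Set Γ) = ⊤) {k : ℕ} (x : Fin (k + 1) → Γ) :
    spread S x ≤ 2 * (1 + ∑ i, wordLength S (x i)) := by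
  have h : (Finset.univ.sup fun p : Fin (k + 1) × Fin (k + 1) =>
      wordLength S ((x p.1)⁻¹ * x p.2)) ≤ 2 * ∑ i, wordLength S (x i) := by
    refine Finset.sup_le fun p _ => ?_
    have h1 := wordLength_mul_le hS (x p.1)⁻¹ (x p.2)
    rw [wordLength_inv hS] at h1
    have h2 : ∀ i, wordLength S (x i) ≤ ∑ i, wordLength S (x i) := fun i =>
      Finset.single_le_sum (f := fun i => wordLength S (x i)) (fun _ _ => Nat.zero_le _)
        (Finset.mem_univ i)
    have := h2 p.1
    have := h2 p.2
    omega
  unfold spread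
  omega

end WordLength

/-! ### The homogeneous coboundary and a contracting homotopy -/

section Homotopy

variable {Γ A : Type*} [AddCommGroup A]

/-- The homogeneous coboundary operator for cochains with values in any abelian group. It is applied
to `V`-valued cochains and to families of simplicial chains indexed by tuples of group elements. -/
def altDiff {k : ℕ} : Cochain Γ A k →+ Cochain Γ A (k + 1) where
  toFun z x := ∑ i : Fin (k + 2), (-1 : ℤ) ^ (i : ℕ) • z fun j => x (i.succAbove j)
  map_zero' := by
    funext x
    simp
  map_add' a b := by
    funext x
    simp [Finset.sum_add_distrib]

theorem altDiff_apply {k : ℕ} (z : Cochain Γ A k) (x : Fin (k + 2) → Γ) :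
    altDiff z x = ∑ i : Fin (k + 2), (-1 : ℤ) ^ (i : ℕ) • z fun j => x (i.succAbove j) := rfl

/-- Evaluation of the first variable of a cochain at `a`: the map dual to coning at `a`. -/
def cone (a : Γ) {k : ℕ} : Cochain Γ A (k + 1) →+ Cochain Γ A k where
  toFun z y := z (Fin.cons a y)
  map_zero' := rfl
  map_add' _ _ := rfl

theorem cone_apply (a : Γ) {k : ℕ} (z : Cochain Γ A (k + 1)) (y : Fin (k + 1) → Γ) :
    cone a z y = z (Fin.cons a y) := rfl

theorem cone_altDiff (a : Γ) {k : ℕ} (z : Cochain Γ A (k + 1)) :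
    cone a (altDiff z) = z - altDiff (cone a z) := by
  funext y
  have h : ∀ i : Fin (k + 2), (fun j => (Fin.cons a y : Fin (k + 3) → Γ) (i.succ.succAbove j)) =
      Fin.cons a fun j => y (i.succAbove j) := by
    intro i
    funext j
    refine Fin.cases ?_ (fun j => ?_) j
    · simp
    · simp
  rw [cone_apply, altDiff_apply, Fin.sum_univ_succ, Pi.sub_apply, altDiff_apply, sub_eq_add_neg,
    ← Finset.sum_neg_distrib]
  congr 1
  · simp
  · refine Finset.sum_congr rfl fun i _ => ?_
    rw [h, cone_apply, Fin.val_succ, pow_succ]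
    simp

theorem cone_altDiff_zero (a : Γ) (z : Cochain Γ A 0) :
    cone a (altDiff z) = z - fun _ => z fun _ => a := by
  funext y
  have : (fun j : Fin 1 => (Fin.cons a y : Fin 2 → Γ) (Fin.succAbove 1 j)) = fun _ => a := by
    funext j
    fin_cases j
    rfl
  simp [cone_apply, altDiff_apply, Fin.sum_univ_two, sub_eq_add_neg, this]

theorem ext_cone {k : ℕ} {z w : Cochain Γ A (k + 1)} (h : ∀ a, cone a z = cone a w) : z = w := by
  funext x
  have := congrFun (h (x 0)) (Fin.tail x)
  simpa [cone_apply, Fin.cons_self_tail] using this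

@[simp]
theorem altDiff_altDiff {k : ℕ} (z : Cochain Γ A k) : altDiff (altDiff z) = 0 := by
  induction k with
  | zero =>
    refine ext_cone fun a => ?_
    rw [cone_altDiff, cone_altDiff_zero, map_sub, sub_sub_cancel, map_zero]
    funext x
    simp [altDiff_apply, Fin.sum_univ_two]
  | succ k ih =>
    refine ext_cone fun a => ?_
    rw [cone_altDiff, cone_altDiff, map_sub, ih, sub_zero, sub_self, map_zero]

/-- The homotopy between a family `P` of operators on cochains and the identity that comes from
coning off: dually, the `(k + 1)`-chain assigned to `x` is the cone with apex `x 0` over the cycle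
`P x - x - (homotopy applied to the faces of x)`. -/
def coneHomotopy (P : ∀ k, Cochain Γ A k →+ Cochain Γ A k) :
    ∀ k, Cochain Γ A (k + 1) → Cochain Γ A k
  | 0, z, x => P 0 (cone (x 0) z) x - cone (x 0) z x
  | k + 1, z, x => P (k + 1) (cone (x 0) z) x - cone (x 0) z x -
      altDiff (coneHomotopy P k (cone (x 0) z)) x

theorem coneHomotopy_sub (P : ∀ k, Cochain Γ A k →+ Cochain Γ A k) (k : ℕ)
    (z w : Cochain Γ A (k + 1)) :
    coneHomotopy P k (z - w) = coneHomotopy P k z - coneHomotopy P k w := by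
  induction k with
  | zero =>
    funext x
    simp only [coneHomotopy, map_sub, Pi.sub_apply]
    abel
  | succ k ih =>
    funext x
    simp only [coneHomotopy, map_sub, Pi.sub_apply, ih]
    abel

theorem coneHomotopy_altDiff_zero (P : ∀ k, Cochain Γ A k →+ Cochain Γ A k)
    (h0 : ∀ v, P 0 (fun _ => v) = fun _ => v) (z : Cochain Γ A 0) :
    coneHomotopy P 0 (altDiff z) = P 0 z - z := by
  funext x
  simp only [coneHomotopy, cone_altDiff_zero, map_sub, Pi.sub_apply, h0]
  abel

theorem altDiff_coneHomotopy_add (P : ∀ k, Cochain Γ A k →+ Cochain Γ A k)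
    (h0 : ∀ v, P 0 (fun _ => v) = fun _ => v) {n : ℕ}
    (hP : ∀ k < n, ∀ z, P (k + 1) (altDiff z) = altDiff (P k z)) (k : ℕ) (hk : k < n)
    (z : Cochain Γ A (k + 1)) :
    altDiff (coneHomotopy P k z) + coneHomotopy P (k + 1) (altDiff z) = P (k + 1) z - z := by
  -- The correction terms vanish: `P - 1 - δQ` kills coboundaries, by the previous degree.
  have key : ∀ w : Cochain Γ A k,
      P (k + 1) (altDiff w) - altDiff w - altDiff (coneHomotopy P k (altDiff w)) = 0 := by
    intro w
    rw [hP k hk, ← map_sub, ← map_sub]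
    cases k with
    | zero => rw [coneHomotopy_altDiff_zero P h0, sub_self, map_zero]
    | succ k =>
      have ih := altDiff_coneHomotopy_add P h0 hP k (by omega) w
      rw [← ih, add_sub_cancel_right, altDiff_altDiff]
  funext x
  have h := congrFun (key (cone (x 0) z)) x
  simp only [Pi.sub_apply, Pi.zero_apply, Pi.add_apply] at h ⊢
  simp only [coneHomotopy, cone_altDiff, map_sub, Pi.sub_apply, coneHomotopy_sub]
  rw [← sub_eq_zero, ← neg_eq_zero, ← h]
  abel

end Homotopy

/-! ### Integral chains: mass, translates, and the pairing with cochains -/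

section Mass

variable {ι κ : Type*}

/-- The sum of the absolute values of the coefficients over all ordered simplices; on
`(Fin (n + 1) → ι) →₀ ℤ` it is `(n + 1)!` times the norm `l1Norm`. -/
def mass (c : ι →₀ ℤ) : ℕ := ∑ τ ∈ c.support, (c τ).natAbs

theorem mass_eq_sum {c : ι →₀ ℤ} {s : Finset ι} (h : c.support ⊆ s) :
    mass c = ∑ τ ∈ s, (c τ).natAbs :=
  Finset.sum_subset h fun τ _ hτ => by simpa using hτ

@[simp]
theorem mass_zero : mass (0 : ι →₀ ℤ) = 0 := by simp [mass]

@[simp]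
theorem mass_neg (c : ι →₀ ℤ) : mass (-c) = mass c := by simp [mass]

@[simp]
theorem mass_single (τ : ι) (a : ℤ) : mass (Finsupp.single τ a) = a.natAbs := by
  classical
  rw [mass_eq_sum (s := {τ}) Finsupp.support_single_subset]
  simp

theorem eq_zero_of_mass_eq_zero {c : ι →₀ ℤ} (h : mass c = 0) : c = 0 := by
  ext τ
  by_contra hτ
  have := (Finset.sum_eq_zero_iff.1 h) τ (by simpa using hτ)
  exact hτ (by simpa using this)

theorem mass_add_le (a b : ι →₀ ℤ) : mass (a + b) ≤ mass a + mass b := by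
  classical
  rw [mass_eq_sum (Finsupp.support_add (g₁ := a) (g₂ := b)),
    mass_eq_sum (c := a) Finset.subset_union_left, mass_eq_sum (c := b) Finset.subset_union_right,
    ← Finset.sum_add_distrib]
  exact Finset.sum_le_sum fun τ _ => Int.natAbs_add_le _ _

theorem mass_neg_one_pow_smul (i : ℕ) (c : ι →₀ ℤ) : mass ((-1 : ℤ) ^ i • c) = mass c := by
  rcases neg_one_pow_eq_or ℤ i with h | h <;> simp [h]

theorem mass_sum_le {α : Type*} (s : Finset α) (f : α → ι →₀ ℤ) :
    mass (∑ i ∈ s, f i) ≤ ∑ i ∈ s, mass (f i) := by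
  classical
  induction s using Finset.induction_on with
  | empty => simp
  | insert a s ha ih =>
    rw [Finset.sum_insert ha, Finset.sum_insert ha]
    exact (mass_add_le _ _).trans (Nat.add_le_add_left ih _)

theorem card_support_le_mass (c : ι →₀ ℤ) : c.support.card ≤ mass c := by
  rw [Finset.card_eq_sum_ones]
  refine Finset.sum_le_sum fun τ hτ => ?_
  have : c τ ≠ 0 := by simpa using hτ
  omega

theorem mass_filter_add (c : ι →₀ ℤ) (p : ι → Prop) [DecidablePred p] :
    mass (c.filter p) + mass (c.filter fun τ => ¬ p τ) = mass c := by
  rw [mass_eq_sum (c := c.filter p) (s := c.support) (by simp [Finsupp.support_filter]),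
    mass_eq_sum (c := c.filter fun τ => ¬ p τ) (s := c.support) (by simp [Finsupp.support_filter]),
    ← Finset.sum_add_distrib]
  refine Finset.sum_congr rfl fun τ _ => ?_
  by_cases h : p τ <;> simp [h]

theorem mass_mapDomain {f : ι → κ} (hf : Function.Injective f) (c : ι →₀ ℤ) :
    mass (c.mapDomain f) = mass c := by
  classical
  rw [mass, Finsupp.mapDomain_support_of_injective hf, Finset.sum_image fun _ _ _ _ h => hf h]
  simp [Finsupp.mapDomain_apply hf, mass]

theorem l1Norm_eq {n : ℕ} (c : (Fin (n + 1) → ι) →₀ ℤ) :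
    l1Norm c = (mass c : ℝ≥0∞) / (Nat.factorial (n + 1) : ℝ≥0∞) := rfl

end Mass

section Chains

variable {ι : Type*} {X : AbstractSimplicialComplex ι}

theorem boundary_apply_eq {n : ℕ} (c : (Fin (n + 2) → ι) →₀ ℤ) :
    boundary c = c.mapDomain Fin.tail := rfl

theorem exists_tail_of_boundary_ne_zero {n : ℕ} {c : (Fin (n + 2) → ι) →₀ ℤ} {σ : Fin (n + 1) → ι}
    (h : boundary c σ ≠ 0) : ∃ τ ∈ c.support, Fin.tail τ = σ := by
  classical
  have := Finsupp.mapDomain_support (f := Fin.tail) (s := c)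
    (Finsupp.mem_support_iff.2 h)
  simpa using this

theorem exists_face_of_mem_support {n : ℕ} {c : (Fin (n + 1) → ι) →₀ ℤ}
    (hc : c ∈ simplicialChains X n) {τ : Fin (n + 1) → ι} (hτ : τ ∈ c.support) :
    ∃ s ∈ X.faces, ∀ i, τ i ∈ s := by
  obtain ⟨-, s, hs, h⟩ := hc.1 τ (by simpa using hτ)
  refine ⟨s, hs, fun i => ?_⟩
  have : τ i ∈ (s : Set ι) := by rw [h]; exact ⟨i, rfl⟩
  simpa using this

variable {Γ : Type*} [Group Γ] [MulAction Γ ι]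

/-- The translate of a chain by a group element. -/
def translateChain (g : Γ) {n : ℕ} :
    ((Fin (n + 1) → ι) →₀ ℤ) →+ ((Fin (n + 1) → ι) →₀ ℤ) :=
  Finsupp.mapDomain.addMonoidHom fun τ i => g • τ i

theorem translateChain_eq (g : Γ) {n : ℕ} (c : (Fin (n + 1) → ι) →₀ ℤ) :
    translateChain g c = c.mapDomain fun τ i => g • τ i := rfl

theorem smul_tuple_injective (g : Γ) (n : ℕ) :
    Function.Injective fun (τ : Fin (n + 1) → ι) i => g • τ i := fun τ τ' h => by
  funext i
  exact MulAction.injective g (congrFun h i)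

theorem translateChain_apply (g : Γ) {n : ℕ} (c : (Fin (n + 1) → ι) →₀ ℤ) (τ : Fin (n + 1) → ι) :
    translateChain g c τ = c fun i => g⁻¹ • τ i := by
  have h := Finsupp.mapDomain_apply (smul_tuple_injective (ι := ι) g n) c fun i => g⁻¹ • τ i
  simpa [translateChain_eq] using h

theorem mem_support_translateChain {g : Γ} {n : ℕ} {c : (Fin (n + 1) → ι) →₀ ℤ}
    {τ : Fin (n + 1) → ι} :
    τ ∈ (translateChain g c).support ↔ (fun i => g⁻¹ • τ i) ∈ c.support := by
  simp [translateChain_apply]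

theorem mass_translateChain (g : Γ) {n : ℕ} (c : (Fin (n + 1) → ι) →₀ ℤ) :
    mass (translateChain g c) = mass c :=
  mass_mapDomain (smul_tuple_injective g n) c

theorem translateChain_mul (g h : Γ) {n : ℕ} (c : (Fin (n + 1) → ι) →₀ ℤ) :
    translateChain (g * h) c = translateChain g (translateChain h c) := by
  ext τ
  simp [translateChain_apply, mul_smul]

theorem boundary_translateChain (g : Γ) {n : ℕ} (c : (Fin (n + 2) → ι) →₀ ℤ) :
    boundary (translateChain g c) = translateChain g (boundary c) := by
  rw [boundary_apply_eq, boundary_apply_eq, translateChain_eq, translateChain_eq,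
    ← Finsupp.mapDomain_comp, ← Finsupp.mapDomain_comp]
  rfl

theorem translateChain_mem (hact : IsSimplicialAction Γ X) (g : Γ) {n : ℕ}
    {c : (Fin (n + 1) → ι) →₀ ℤ} (hc : c ∈ simplicialChains X n) :
    translateChain g c ∈ simplicialChains X n := by
  refine ⟨fun τ hτ => ?_, fun σ τ => ?_⟩
  · rw [translateChain_apply] at hτ
    obtain ⟨h1, s, hs, h2⟩ := hc.1 _ hτ
    refine ⟨fun i j h => h1 (by simp [h]), translate g s, hact g s hs, ?_⟩
    simp only [translate, Finset.coe_map, h2]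
    ext v
    simp
  · rw [translateChain_apply, translateChain_apply]
    exact hc.2 σ fun i => g⁻¹ • τ i

end Chains

section Pairing

variable {Γ ι : Type*} (𝕜 : Type*) [RCLike 𝕜] {V : Type*} [NormedAddCommGroup V] [NormedSpace 𝕜 V]

/-- The value at a simplicial chain of the pullback of a cochain on `Γ` along a map `g` from the
vertices of the complex to `Γ`. Since a chain is recorded by its coefficients on all orderings of
its simplices, the sum is divided by the number of orderings. -/
def pairing (g : ι → Γ) {k : ℕ} (z : Cochain Γ V k) : ((Fin (k + 1) → ι) →₀ ℤ) →+ V where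
  toFun c := ((k + 1).factorial : 𝕜)⁻¹ • c.sum fun τ a => a • z fun i => g (τ i)
  map_zero' := by simp
  map_add' a b := by
    rw [Finsupp.sum_add_index' (by simp) (by simp [add_smul]), smul_add]

theorem pairing_apply (g : ι → Γ) {k : ℕ} (z : Cochain Γ V k) (c : (Fin (k + 1) → ι) →₀ ℤ) :
    pairing 𝕜 g z c = ((k + 1).factorial : 𝕜)⁻¹ • c.sum fun τ a => a • z fun i => g (τ i) := rfl

/-- Deleting the `i`-th vertex amounts to the cyclic permutation `i.cycleRange`, of sign `(-1) ^ i`,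
followed by the deletion of the first vertex. -/
theorem sum_comp_succAbove {ι V : Type*} [AddCommGroup V] {k : ℕ} {c : (Fin (k + 2) → ι) →₀ ℤ}
    (hc : ∀ (σ : Equiv.Perm (Fin (k + 2))) (τ : Fin (k + 2) → ι),
      c (τ ∘ σ) = (Equiv.Perm.sign σ : ℤ) * c τ) (w : (Fin (k + 1) → ι) → V) (i : Fin (k + 2)) :
    (c.sum fun τ a => a • w fun j => τ (i.succAbove j)) =
      (-1 : ℤ) ^ (i : ℕ) • c.sum fun τ a => a • w (Fin.tail τ) := by
  have hs : ∀ τ : Fin (k + 2) → ι,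
      c (τ ∘ i.cycleRange) = (-1 : ℤ) ^ (i : ℕ) * c τ := by
    intro τ
    rw [hc, Fin.sign_cycleRange]
    simp
  rw [Finsupp.sum, Finsupp.sum, Finset.smul_sum]
  refine Finset.sum_bij' (fun τ _ => τ ∘ i.cycleRange.symm) (fun τ _ => τ ∘ i.cycleRange)
    (fun τ hτ => ?_) (fun τ hτ => ?_) (fun τ _ => ?_) (fun τ _ => ?_) (fun τ _ => ?_)
  · rw [Finsupp.mem_support_iff] at hτ ⊢
    rw [hc]
    exact mul_ne_zero (by simp) hτ
  · rw [Finsupp.mem_support_iff] at hτ ⊢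
    rw [hc]
    exact mul_ne_zero (by simp) hτ
  · funext j
    simp
  · funext j
    simp
  · have h := hs (τ ∘ i.cycleRange.symm)
    have h' : (τ ∘ i.cycleRange.symm) ∘ i.cycleRange = τ := by
      funext j
      simp
    rw [h'] at h
    have ht : Fin.tail (τ ∘ i.cycleRange.symm) = fun j => τ (i.succAbove j) := by
      funext j
      simp [Fin.tail, Fin.cycleRange_symm_succ]
    rw [h, smul_smul, ht]

/-- Pulling back cochains along `g` is compatible with the coboundary and the boundary. -/
theorem pairing_altDiff (g : ι → Γ) {X : AbstractSimplicialComplex ι} {k : ℕ} (z : Cochain Γ V k)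
    {c : (Fin (k + 2) → ι) →₀ ℤ} (hc : c ∈ simplicialChains X (k + 1)) :
    pairing 𝕜 g (altDiff z) c = pairing 𝕜 g z (boundary c) := by
  have h1 : (c.sum fun τ a => a • altDiff z fun i => g (τ i)) =
      (k + 2) • c.sum fun τ a => a • z fun j => g (Fin.tail τ j) := by
    calc (c.sum fun τ a => a • altDiff z fun i => g (τ i))
        = ∑ i : Fin (k + 2), (-1 : ℤ) ^ (i : ℕ) •
            c.sum fun τ a => a • z fun j => g (τ (i.succAbove j)) := by
          simp only [altDiff_apply, Finset.smul_sum, Finsupp.sum]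
          rw [Finset.sum_comm]
          exact Finset.sum_congr rfl fun i _ => Finset.sum_congr rfl fun τ _ => smul_comm _ _ _
      _ = ∑ i : Fin (k + 2), c.sum fun τ a => a • z fun j => g (Fin.tail τ j) := by
          refine Finset.sum_congr rfl fun i _ => ?_
          rw [sum_comp_succAbove hc.2 (fun y => z fun j => g (y j)) i, smul_smul, ← mul_pow]
          simp
      _ = _ := by simp
  rw [pairing_apply, pairing_apply, h1, boundary_apply_eq, Finsupp.sum_mapDomain_index (by simp)
    (by simp [add_smul]), Nat.factorial_succ (k + 1), ← Nat.cast_smul_eq_nsmul 𝕜, smul_smul]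
  congr 1
  have : ((k + 2 : ℕ) : 𝕜) ≠ 0 := by exact_mod_cast (by omega : k + 2 ≠ 0)
  rw [Nat.cast_mul, mul_inv, mul_comm, ← mul_assoc, mul_inv_cancel₀ this, one_mul]

theorem norm_pairing_le (g : ι → Γ) {k : ℕ} (z : Cochain Γ V k) (c : (Fin (k + 1) → ι) →₀ ℤ)
    {B : ℝ} (h : ∀ τ ∈ c.support, ‖z fun i => g (τ i)‖ ≤ B) :
    ‖pairing 𝕜 g z c‖ ≤ mass c * B := by
  have h1 : ‖((k + 1).factorial : 𝕜)⁻¹‖ ≤ 1 := by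
    rw [norm_inv, RCLike.norm_natCast]
    exact inv_le_one_of_one_le₀ (by exact_mod_cast Nat.succ_le_of_lt (Nat.factorial_pos _))
  rw [pairing_apply, norm_smul]
  refine (mul_le_of_le_one_left (norm_nonneg _) h1).trans ((norm_sum_le _ _).trans ?_)
  rw [mass, Nat.cast_sum, Finset.sum_mul]
  refine Finset.sum_le_sum fun τ hτ => ?_
  calc ‖c τ • z fun i => g (τ i)‖ ≤ ‖c τ‖ * ‖z fun i => g (τ i)‖ := norm_zsmul_le _ _
    _ ≤ ((c τ).natAbs : ℝ) * B := by
      rw [Int.norm_eq_abs, Nat.cast_natAbs, Int.cast_abs]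
      exact mul_le_mul_of_nonneg_left (h τ hτ) (abs_nonneg _)

end Pairing

/-! ### Minimal fillings -/

section Fillings

variable {ι : Type*} (X : AbstractSimplicialComplex ι)

/-- The chain `b` is a filling of `c` in `X`. -/
def IsFilling {n : ℕ} (c : (Fin (n + 1) → ι) →₀ ℤ) (b : (Fin (n + 2) → ι) →₀ ℤ) : Prop :=
  b ∈ simplicialChains X (n + 1) ∧ boundary b = c

variable {X}

theorem exists_minimal_filling {n : ℕ} {c : (Fin (n + 1) → ι) →₀ ℤ} (h : ∃ b, IsFilling X c b) :
    ∃ b, IsFilling X c b ∧ ∀ b', IsFilling X c b' → mass b ≤ mass b' := by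
  classical
  have h' : ∃ m, ∃ b, IsFilling X c b ∧ mass b = m := by
    obtain ⟨b, hb⟩ := h
    exact ⟨_, b, hb, rfl⟩
  obtain ⟨b, hb, hm⟩ := Nat.find_spec h'
  exact ⟨b, hb, fun b' hb' => hm ▸ Nat.find_min' h' ⟨b', hb', rfl⟩⟩

variable (X) in
open Classical in
/-- A filling of `c` of minimal mass, and `0` if `c` has no filling. -/
def minFilling {n : ℕ} (c : (Fin (n + 1) → ι) →₀ ℤ) : (Fin (n + 2) → ι) →₀ ℤ :=
  if h : ∃ b, IsFilling X c b then (exists_minimal_filling h).choose else 0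

theorem isFilling_minFilling {n : ℕ} {c : (Fin (n + 1) → ι) →₀ ℤ} (h : ∃ b, IsFilling X c b) :
    IsFilling X c (minFilling X c) := by
  rw [minFilling, dif_pos h]
  exact (exists_minimal_filling h).choose_spec.1

theorem mass_minFilling_le {n : ℕ} {c : (Fin (n + 1) → ι) →₀ ℤ} {b : (Fin (n + 2) → ι) →₀ ℤ}
    (hb : IsFilling X c b) : mass (minFilling X c) ≤ mass b := by
  rw [minFilling, dif_pos ⟨b, hb⟩]
  exact (exists_minimal_filling ⟨b, hb⟩).choose_spec.2 b hb

theorem minFilling_mem {n : ℕ} (c : (Fin (n + 1) → ι) →₀ ℤ) :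
    minFilling X c ∈ simplicialChains X (n + 1) := by
  by_cases h : ∃ b, IsFilling X c b
  · exact (isFilling_minFilling h).1
  · rw [minFilling, dif_neg h]
    exact zero_mem _

/-- The graph on the ordered simplices of a chain in which simplices with a common vertex are
adjacent. -/
def supportGraph {n : ℕ} (b : (Fin (n + 1) → ι) →₀ ℤ) : SimpleGraph b.support where
  Adj τ τ' := τ ≠ τ' ∧ ∃ i j, τ.1 i = τ'.1 j
  symm := ⟨fun _ _ ⟨hne, i, j, e⟩ => ⟨hne.symm, j, i, e.symm⟩⟩
  loopless := ⟨fun _ h => h.1 rfl⟩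

theorem reachable_supportGraph {n : ℕ} {b : (Fin (n + 1) → ι) →₀ ℤ} {τ τ' : b.support}
    (h : ∃ i j, τ.1 i = τ'.1 j) : (supportGraph b).Reachable τ τ' := by
  by_cases e : τ = τ'
  · rw [e]
  · exact SimpleGraph.Adj.reachable ⟨e, h⟩

theorem wordLength_le_of_walk {Γ : Type*} [Group Γ] {S : Finset Γ}
    (hS : Subgroup.closure (S : Set Γ) = ⊤) {g : ι → Γ} {D : ℕ}
    (hD : ∀ s ∈ X.faces, ∀ v ∈ s, ∀ w ∈ s, wordLength S ((g v)⁻¹ * g w) ≤ D) {n : ℕ}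
    {b : (Fin (n + 1) → ι) →₀ ℤ} (hb : b ∈ simplicialChains X n) {τ τ' : b.support}
    (p : (supportGraph b).Walk τ τ') (i j : Fin (n + 1)) :
    wordLength S ((g (τ'.1 j))⁻¹ * g (τ.1 i)) ≤ D * (p.length + 1) := by
  have hD' : ∀ (τ : b.support) i j, wordLength S ((g (τ.1 i))⁻¹ * g (τ.1 j)) ≤ D := by
    intro τ i j
    obtain ⟨s, hs, h⟩ := exists_face_of_mem_support hb τ.2
    exact hD s hs _ (h i) _ (h j)
  induction p generalizing i with
  | nil => simpa using hD' _ j i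
  | @cons τ τ₁ τ' h p ih =>
    have hadj := h
    obtain ⟨-, i', j', e⟩ := hadj
    have h1 := ih j'
    have h2 := hD' τ i' i
    have h3 := wordLength_dist_triangle hS (g (τ'.1 j)) (g (τ.1 i')) (g (τ.1 i))
    rw [e] at h2 h3
    rw [SimpleGraph.Walk.length_cons]
    linarith

/-- A filling of minimal mass stays close to the cycle that it fills: the components of its support
that do not touch the cycle are cycles themselves, so they can be discarded. -/
theorem exists_near_of_minimal {Γ : Type*} [Group Γ] {S : Finset Γ}
    (hS : Subgroup.closure (S : Set Γ) = ⊤) {g : ι → Γ} {D : ℕ}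
    (hD : ∀ s ∈ X.faces, ∀ v ∈ s, ∀ w ∈ s, wordLength S ((g v)⁻¹ * g w) ≤ D) {n : ℕ}
    {b : (Fin (n + 2) → ι) →₀ ℤ} (hb : b ∈ simplicialChains X (n + 1))
    (hmin : ∀ b', IsFilling X (boundary b) b' → mass b ≤ mass b') {τ : Fin (n + 2) → ι}
    (hτ : τ ∈ b.support) (i : Fin (n + 2)) :
    ∃ σ ∈ (boundary b).support, wordLength S ((g (σ 0))⁻¹ * g (τ i)) ≤ D * mass b := by
  classical
  let p : (Fin (n + 2) → ι) → Prop := fun τ => ∃ h : τ ∈ b.support, ∃ τ₀ : b.support,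
    (supportGraph b).Reachable ⟨τ, h⟩ τ₀ ∧ Fin.tail τ₀.1 ∈ (boundary b).support
  have hp : ∀ τ τ', τ ∈ b.support → p τ' → (∃ i j, τ i = τ' j) → p τ := by
    rintro τ τ' h ⟨h', τ₀, hr, ht⟩ hij
    exact ⟨h, τ₀, (reachable_supportGraph (τ := ⟨τ, h⟩) (τ' := ⟨τ', h'⟩) hij).trans hr, ht⟩
  have hadd : b.filter p + b.filter (fun τ => ¬ p τ) = b := Finsupp.filter_add_filter_not b p
  have hmem : b.filter p ∈ simplicialChains X (n + 1) := by
    refine ⟨fun τ h => hb.1 τ fun h0 => h ?_, fun σ τ => ?_⟩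
    · by_cases hpτ : p τ
      · rwa [Finsupp.filter_apply_pos _ _ hpτ]
      · exact Finsupp.filter_apply_neg _ _ hpτ
    · have hiff : p (τ ∘ σ) ↔ p τ := by
        have h0 : τ ∘ σ ∈ b.support ↔ τ ∈ b.support := by
          simp [hb.2 σ τ]
        refine ⟨fun h => hp _ _ (h0.1 h.1) h ⟨σ 0, 0, rfl⟩,
          fun h => hp _ _ (h0.2 h.1) h ⟨0, σ 0, rfl⟩⟩
      by_cases h : p τ
      · rw [Finsupp.filter_apply_pos _ _ h, Finsupp.filter_apply_pos _ _ (hiff.2 h), hb.2]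
      · rw [Finsupp.filter_apply_neg _ _ h, Finsupp.filter_apply_neg _ _ (mt hiff.1 h), mul_zero]
  have hzero : boundary (b.filter fun τ => ¬ p τ) = 0 := by
    ext σ
    by_contra hσ
    obtain ⟨τ', hτ', rfl⟩ := exists_tail_of_boundary_ne_zero hσ
    rw [Finsupp.support_filter, Finset.mem_filter] at hτ'
    have hne : boundary b (Fin.tail τ') = 0 := by
      by_contra h
      exact hτ'.2 ⟨hτ'.1, ⟨τ', hτ'.1⟩, .rfl, Finsupp.mem_support_iff.2 h⟩
    have h1 : boundary (b.filter p) (Fin.tail τ') ≠ 0 := by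
      intro h
      rw [← hadd, map_add, Finsupp.add_apply, h, zero_add] at hne
      exact hσ hne
    obtain ⟨τ₁, hτ₁, e⟩ := exists_tail_of_boundary_ne_zero h1
    rw [Finsupp.support_filter, Finset.mem_filter] at hτ₁
    exact hτ'.2 (hp _ _ hτ'.1 hτ₁.2 ⟨1, 1, (congrFun e 0).symm⟩)
  have hfill : boundary (b.filter p) = boundary b := by
    conv_rhs => rw [← hadd, map_add, hzero, add_zero]
  have hmass := hmin _ ⟨hmem, hfill⟩
  have hmass' := mass_filter_add b p
  have hz : b.filter (fun τ => ¬ p τ) = 0 := eq_zero_of_mass_eq_zero (by omega)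
  have hpτ : p τ := by
    by_contra h
    have h1 : (b.filter fun τ => ¬ p τ) τ = b τ := Finsupp.filter_apply_pos _ _ h
    rw [hz] at h1
    exact (Finsupp.mem_support_iff.1 hτ) h1.symm
  obtain ⟨h, τ₀, ⟨w⟩, ht⟩ := hpτ
  refine ⟨_, ht, ?_⟩
  have h1 := wordLength_le_of_walk hS hD hb w.toPath.1 i 1
  have h2 := w.toPath.2.length_lt
  rw [Fintype.card_coe] at h2
  exact h1.trans (Nat.mul_le_mul_left _ ((Nat.succ_le_of_lt h2).trans (card_support_le_mass b)))

end Fillings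

/-! ### Growth of functions and degrees -/

section Growth

/-- For exponents `b ≥ 1` the affine terms in `f ≲ t ^ b` can be absorbed. -/
theorem AsympLE.exists_le {f : ℕ → ℝ≥0∞} {a b : ℝ} (h : AsympLE f (powerFun a)) (hab : a ≤ b)
    (hb : 1 ≤ b) :
    ∃ K : ℝ, 0 ≤ K ∧ ∀ n : ℕ, 0 < n → f n ≤ ENNReal.ofReal (K * (n : ℝ) ^ b) := by
  obtain ⟨C, hC, h⟩ := h
  refine ⟨C * (2 * C) ^ b + 2 * C, by positivity, fun n hn => (h n hn).trans ?_⟩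
  have hn1 : (1 : ℝ) ≤ n := by exact_mod_cast hn
  have hC1 : (1 : ℝ) ≤ C := by exact_mod_cast hC
  have h1 : powerFun a (C * n + C) ≤ ENNReal.ofReal ((2 * C) ^ b * (n : ℝ) ^ b) := by
    refine ENNReal.ofReal_le_ofReal ?_
    rw [← Real.mul_rpow (by positivity) (by positivity)]
    push_cast
    calc ((C : ℝ) * n + C) ^ a ≤ ((C : ℝ) * n + C) ^ b :=
          Real.rpow_le_rpow_of_exponent_le (by nlinarith) hab
      _ ≤ (2 * C * n : ℝ) ^ b :=
          Real.rpow_le_rpow (by positivity) (by nlinarith) (by linarith)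
  have h2 : (n : ℝ) ≤ (n : ℝ) ^ b := Real.self_le_rpow_of_one_le hn1 hb
  calc (C : ℝ≥0∞) * powerFun a (C * n + C) + C * n + C
      ≤ C * ENNReal.ofReal ((2 * C) ^ b * (n : ℝ) ^ b) + C * n + C := by gcongr
    _ = ENNReal.ofReal (C * ((2 * C) ^ b * (n : ℝ) ^ b) + C * n + C) := by
        rw [ENNReal.ofReal_add (by positivity) (by positivity),
          ENNReal.ofReal_add (by positivity) (by positivity),
          ENNReal.ofReal_mul (p := (C : ℝ)) (by positivity),
          ENNReal.ofReal_mul (p := (C : ℝ)) (q := (n : ℝ)) (by positivity)]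
        simp only [ENNReal.ofReal_natCast]
    _ ≤ _ := by
        refine ENNReal.ofReal_le_ofReal ?_
        nlinarith

theorem AsympLE.mono_exponent {f : ℕ → ℝ≥0∞} {a b : ℝ} (h : AsympLE f (powerFun a))
    (hab : a ≤ b) : AsympLE f (powerFun b) := by
  obtain ⟨C, hC, h⟩ := h
  refine ⟨C, hC, fun n hn => (h n hn).trans ?_⟩
  gcongr
  refine ENNReal.ofReal_le_ofReal (Real.rpow_le_rpow_of_exponent_le ?_ hab)
  exact_mod_cast Nat.le_add_left_of_le hC

theorem PolynomiallyBounded.exponents_nonempty {f : ℕ → ℝ≥0∞} (h : PolynomiallyBounded f) :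
    {a : ℝ | 1 ≤ a ∧ AsympLE f (powerFun a)}.Nonempty := by
  obtain ⟨a, -, h⟩ := h
  exact ⟨max 1 a, le_max_left _ _, h.mono_exponent (le_max_right _ _)⟩

theorem PolynomiallyBounded.one_le_growthDegree {f : ℕ → ℝ≥0∞} (h : PolynomiallyBounded f) :
    1 ≤ growthDegree f :=
  le_csInf h.exponents_nonempty fun _ ha => ha.1

theorem PolynomiallyBounded.asympLE_of_growthDegree_lt {f : ℕ → ℝ≥0∞} (h : PolynomiallyBounded f)
    {a : ℝ} (ha : growthDegree f < a) : AsympLE f (powerFun a) := by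
  obtain ⟨b, hb, hba⟩ := exists_lt_of_csInf_lt h.exponents_nonempty ha
  exact hb.2.mono_exponent hba.le

theorem rpow_exponent_le {a b K : ℝ} (h : ∀ n : ℕ, 0 < n → (n : ℝ) ^ a ≤ K * (n : ℝ) ^ b) :
    a ≤ b := by
  by_contra! hab
  have h1 : Filter.Tendsto (fun n : ℕ => (n : ℝ) ^ (a - b)) Filter.atTop Filter.atTop :=
    (tendsto_rpow_atTop (sub_pos.2 hab)).comp tendsto_natCast_atTop_atTop
  obtain ⟨n, hn, hn0⟩ := ((h1.eventually_gt_atTop K).and (Filter.eventually_gt_atTop 0)).exists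
  have hn' : (0 : ℝ) < n := by exact_mod_cast hn0
  rw [Real.rpow_sub hn', lt_div_iff₀ (by positivity)] at hn
  exact absurd (h n hn0) (not_le.2 hn)

/-- For a polynomial function the infimum that defines its degree is attained. -/
theorem IsPolynomial.asympLE_growthDegree {f : ℕ → ℝ≥0∞} (h : IsPolynomial f) :
    AsympLE f (powerFun (growthDegree f)) := by
  obtain ⟨a, ha, h1, C, hC, h2⟩ := h
  refine h1.mono_exponent (le_csInf
    (PolynomiallyBounded.exponents_nonempty ⟨a, ha.le, h1⟩) fun b hb => ?_)
  obtain ⟨K, hK, hf⟩ := hb.2.exists_le le_rfl hb.1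
  -- `t ^ a ≲ f ≲ t ^ b` forces `a ≤ b`.
  refine rpow_exponent_le (K := C * (K * (2 * C) ^ b) + 2 * C) fun n hn => ?_
  have hn1 : (1 : ℝ) ≤ n := by exact_mod_cast hn
  have hC1 : (1 : ℝ) ≤ C := by exact_mod_cast hC
  have h3 : (n : ℝ) ≤ (n : ℝ) ^ b := Real.self_le_rpow_of_one_le hn1 hb.1
  have h4 : ((C * n + C : ℕ) : ℝ) ^ b ≤ (2 * C) ^ b * (n : ℝ) ^ b := by
    rw [← Real.mul_rpow (by positivity) (by positivity)]
    push_cast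
    exact Real.rpow_le_rpow (by positivity) (by nlinarith) (by linarith [hb.1])
  have h5 : powerFun a n ≤ ENNReal.ofReal (C * (K * ((2 * C) ^ b * (n : ℝ) ^ b)) + C * n + C) := by
    refine (h2 n hn).trans ?_
    rw [ENNReal.ofReal_add (by positivity) (by positivity),
      ENNReal.ofReal_add (by positivity) (by positivity), ENNReal.ofReal_mul (by positivity),
      ENNReal.ofReal_mul (p := (C : ℝ)) (q := (n : ℝ)) (by positivity)]
    simp only [ENNReal.ofReal_natCast]
    gcongr
    exact (hf _ (by omega)).trans (ENNReal.ofReal_le_ofReal (mul_le_mul_of_nonneg_left h4 hK))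
  have h6 := (ENNReal.ofReal_le_ofReal_iff (by positivity)).1 h5
  nlinarith

end Growth

/-! ### Fillings from the filling functions -/

section FillingFunctions

variable {ι : Type*} {X : AbstractSimplicialComplex ι}

/-- A finite bound for the filling function produces fillings; in particular cycles bound. -/
theorem exists_filling_of_cFV_lt {n : ℕ} {c : (Fin (n + 2) → ι) →₀ ℤ}
    (hc : c ∈ simplicialChains X (n + 1)) (hc0 : boundary c = 0) {T : ℕ} (hT : mass c ≤ T) {B : ℝ}
    (hB : 0 ≤ B) (h : cFV X (n + 2) T ≤ ENNReal.ofReal B) :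
    ∃ b, IsFilling X c b ∧ (mass b : ℝ) ≤ (n + 3).factorial * (B + 1) := by
  have h1 : l1Norm c ≤ (T : ℝ≥0∞) := by
    rw [l1Norm_eq]
    refine (ENNReal.div_le_of_le_mul ?_ : _ ≤ (mass c : ℝ≥0∞)).trans (by exact_mod_cast hT)
    exact le_mul_of_one_le_right' (by exact_mod_cast Nat.succ_le_of_lt (Nat.factorial_pos _))
  have h2 : fillingVolume X c ≤ cFV X (n + 2) T :=
    le_iSup₂_of_le (f := fun (c : (Fin (n + 2) → ι) →₀ ℤ)
      (_ : c ∈ simplicialChains X (n + 1) ∧ boundary c = 0 ∧ l1Norm c ≤ (T : ℝ≥0∞)) =>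
        fillingVolume X c) c ⟨hc, hc0, h1⟩ le_rfl
  have h3 : fillingVolume X c < ENNReal.ofReal (B + 1) :=
    (h2.trans h).trans_lt ((ENNReal.ofReal_lt_ofReal_iff (by linarith)).2 (by linarith))
  rw [fillingVolume, iInf_lt_iff] at h3
  obtain ⟨b, h3⟩ := h3
  rw [iInf_lt_iff] at h3
  obtain ⟨hb, h3⟩ := h3
  refine ⟨b, hb, ?_⟩
  rw [l1Norm_eq, ENNReal.div_lt_iff (by simp [Nat.factorial_ne_zero]) (by simp),
    ← ENNReal.ofReal_natCast, ← ENNReal.ofReal_natCast, ← ENNReal.ofReal_mul (by linarith),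
    ENNReal.ofReal_lt_ofReal_iff (by positivity)] at h3
  rw [mul_comm]
  exact h3.le

end FillingFunctions

/-! ### Connectedness of the one-skeleton -/

section Connected

variable {ι : Type*} {X : AbstractSimplicialComplex ι}

variable (X) in
/-- Two vertices are related if they are joined by a path of edges. -/
def Joined : ι → ι → Prop := Relation.ReflTransGen fun v w => ∃ s ∈ X.faces, v ∈ s ∧ w ∈ s

theorem Joined.of_face {s : Finset ι} (hs : s ∈ X.faces) {v w : ι} (hv : v ∈ s) (hw : w ∈ s) :
    Joined X v w :=
  .single ⟨s, hs, hv, hw⟩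

theorem singleton_mem_faces (X : AbstractSimplicialComplex ι) (v : ι) : {v} ∈ X.faces :=
  X.singleton_mem v

theorem face_of_subset {s t : Finset ι} (hs : s ∈ X.faces) (h : t ⊆ s) (ht : t.Nonempty) :
    t ∈ X.faces :=
  (X.isRelLowerSet_faces hs).2 h ht

theorem edge_mem_faces [DecidableEq ι] {s : Finset ι} (hs : s ∈ X.faces) {v w : ι} (hv : v ∈ s)
    (hw : w ∈ s) : {v, w} ∈ X.faces :=
  face_of_subset hs (Finset.insert_subset hv (Finset.singleton_subset_iff.2 hw)) ⟨v, by simp⟩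

theorem isOpen_realization_iff {U : Set (Realization X)} :
    IsOpen U ↔ ∀ s ∈ X.faces, IsOpen (ClosedSimplex.incl X s ⁻¹' U) := by
  simp only [isOpen_iSup_iff, isOpen_coinduced]

theorem Realization.support_nonempty (x : Realization X) : x.1.support.Nonempty :=
  (X.isRelLowerSet_faces x.2.1).1

/-- The vertex `v` as a point of the realization. -/
def vertexPoint (X : AbstractSimplicialComplex ι) (v : ι) : Realization X :=
  ⟨Finsupp.single v 1, by
    rw [Finsupp.support_single _ one_ne_zero]
    exact singleton_mem_faces X v, fun w => by
    by_cases h : v = w <;> simp [h], by simp⟩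

/-- In a connected complex all vertices are joined by edge paths: for the weak topology, the union
of the simplices whose vertices are joined to `v` is open and closed. -/
theorem joined_of_preconnectedSpace [PreconnectedSpace (Realization X)] (v w : ι) :
    Joined X v w := by
  let U : Set (Realization X) := {x | ∃ u ∈ x.1.support, Joined X v u}
  have hconst : ∀ s ∈ X.faces, ∀ x y : ClosedSimplex X s, x.1 ∈ U → y.1 ∈ U := by
    rintro s hs x y ⟨u, hu, hvu⟩
    obtain ⟨u', hu'⟩ := Realization.support_nonempty y.1
    exact ⟨u', hu', hvu.trans (Joined.of_face hs (x.2 hu) (y.2 hu'))⟩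
  have hpre : ∀ s ∈ X.faces, ClosedSimplex.incl X s ⁻¹' U = ∅ ∨
      ClosedSimplex.incl X s ⁻¹' U = Set.univ := by
    intro s hs
    rcases Set.eq_empty_or_nonempty (ClosedSimplex.incl X s ⁻¹' U) with h | ⟨x, hx⟩
    · exact .inl h
    · exact .inr (Set.eq_univ_of_forall fun y => hconst s hs x y hx)
  have hU : IsClopen U := by
    refine ⟨⟨isOpen_realization_iff.2 fun s hs => ?_⟩, isOpen_realization_iff.2 fun s hs => ?_⟩
    · rw [Set.preimage_compl]
      rcases hpre s hs with h | h <;> simp [h]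
    · rcases hpre s hs with h | h <;> simp [h]
  have huniv : U = Set.univ := hU.eq_univ ⟨vertexPoint X v, v, by simp [vertexPoint], .refl⟩
  have hw : vertexPoint X w ∈ U := huniv ▸ Set.mem_univ _
  obtain ⟨u, hu, h⟩ := hw
  rw [vertexPoint, Finsupp.support_single _ one_ne_zero, Finset.mem_singleton] at hu
  rwa [hu] at h

/-- The `0`-chain of a vertex. -/
def vertexChain (v : ι) : (Fin 1 → ι) →₀ ℤ := Finsupp.single (fun _ => v) 1

theorem vertexChain_mem (v : ι) : vertexChain v ∈ simplicialChains X 0 := by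
  refine ⟨fun τ hτ => ?_, fun σ τ => ?_⟩
  · have : (fun _ => v) = τ := by
      by_contra h
      exact hτ (Finsupp.single_eq_of_ne' h)
    subst this
    exact ⟨fun i j _ => Subsingleton.elim (α := Fin 1) i j, {v}, singleton_mem_faces X v, by simp⟩
  · have : σ = 1 := Subsingleton.elim (α := Equiv.Perm (Fin 1)) _ _
    simp [this]

theorem exists_edge_filling {s : Finset ι} (hs : s ∈ X.faces) {v w : ι} (hv : v ∈ s) (hw : w ∈ s) :
    ∃ b, IsFilling X (vertexChain w - vertexChain v) b := by
  classical
  by_cases hvw : v = w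
  · exact ⟨0, zero_mem _, by simp [hvw]⟩
  refine ⟨Finsupp.single ![v, w] 1 - Finsupp.single ![w, v] 1, ⟨fun τ hτ => ?_, fun σ τ => ?_⟩, ?_⟩
  · have h : τ = ![v, w] ∨ τ = ![w, v] := by
      by_contra! h
      exact hτ (by simp [h.1.symm, h.2.symm])
    have hf := edge_mem_faces hs hv hw
    rcases h with rfl | rfl
    · refine ⟨fun i j hij => ?_, _, hf, ?_⟩
      · fin_cases i <;> fin_cases j <;> simp_all [eq_comm]
      · simp [Matrix.range_cons, Set.pair_comm]
    · refine ⟨fun i j hij => ?_, _, hf, ?_⟩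
      · fin_cases i <;> fin_cases j <;> simp_all [eq_comm]
      · simp [Matrix.range_cons, Set.pair_comm]
  · have hσ : σ = 1 ∨ σ = Equiv.swap 0 1 := by
      revert σ
      decide
    rcases hσ with rfl | rfl
    · simp
    · have h1 : ∀ a b : ι, (![a, b] = τ ∘ Equiv.swap 0 1) ↔ (![b, a] = τ) := by
        intro a b
        simp only [funext_iff, Fin.forall_fin_two]
        simp [and_comm]
      simp [Finsupp.single_apply, h1]
  · rw [map_sub, boundary_apply_eq, boundary_apply_eq, Finsupp.mapDomain_single,
      Finsupp.mapDomain_single]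
    congr 2 <;> funext i <;> fin_cases i <;> rfl

theorem exists_filling_of_joined {v w : ι} (h : Joined X v w) :
    ∃ b, IsFilling X (vertexChain w - vertexChain v) b := by
  induction h with
  | refl => exact ⟨0, zero_mem _, by simp⟩
  | tail _ h ih =>
    obtain ⟨b, hb, hb'⟩ := ih
    obtain ⟨s, hs, h1, h2⟩ := h
    obtain ⟨e, he, he'⟩ := exists_edge_filling hs h1 h2
    exact ⟨e + b, add_mem he hb, by rw [map_add, hb', he']; abel⟩

end Connected

/-! ### From the complex to the group -/

section VertexMap

variable {Γ ι : Type*} [Group Γ] [MulAction Γ ι] {X : AbstractSimplicialComplex ι}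

theorem IsFreeAction.eq_of_smul_eq (hfree : IsFreeAction Γ X) {a b : Γ} {v : ι}
    (h : a • v = b • v) : a = b := by
  have h1 : b⁻¹ * a = 1 := hfree _ {v} (singleton_mem_faces X v) (by
    simp [translate, mul_smul, h])
  rw [← inv_mul_eq_one, ← inv_inj]
  simpa using h1

/-- For a free action, the choice of a vertex in every orbit determines an equivariant map from the
vertices to the group. -/
theorem exists_equivariant_vertexMap (hfree : IsFreeAction Γ X) :
    ∃ g : ι → Γ, ∀ (γ : Γ) (v : ι), g (γ • v) = γ * g v := by
  have h : ∀ v : ι, ∃ a : Γ, a • (Quotient.mk (MulAction.orbitRel Γ ι) v).out = v := by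
    intro v
    have := Quotient.exact (Quotient.out_eq (Quotient.mk (MulAction.orbitRel Γ ι) v))
    obtain ⟨a, ha⟩ := (MulAction.orbitRel_apply.1 this)
    exact ⟨a⁻¹, by rw [← ha]; simp⟩
  choose g hg using h
  refine ⟨g, fun γ v => hfree.eq_of_smul_eq (v := (Quotient.mk (MulAction.orbitRel Γ ι) v).out) ?_⟩
  have h1 := hg (γ • v)
  have h2 : Quotient.mk (MulAction.orbitRel Γ ι) (γ • v) = Quotient.mk (MulAction.orbitRel Γ ι) v :=
    Quotient.sound ⟨γ, rfl⟩
  rw [h2] at h1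
  rw [h1, mul_smul, hg]

/-- Since there are finitely many orbits of edges, an equivariant map to the group is Lipschitz. -/
theorem exists_edge_bound (S : Finset Γ) {n : ℕ} (hn : 1 ≤ n) (hcoc : HasCocompactSkeleton Γ X n)
    {g : ι → Γ} (hg : ∀ (γ : Γ) (v : ι), g (γ • v) = γ * g v) :
    ∃ D : ℕ, ∀ s ∈ X.faces, ∀ v ∈ s, ∀ w ∈ s, wordLength S ((g v)⁻¹ * g w) ≤ D := by
  classical
  obtain ⟨T, hT, h⟩ := hcoc
  let F : Finset (ι × ι) := hT.toFinset.biUnion fun t => t ×ˢ t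
  refine ⟨F.sup fun p => wordLength S ((g p.1)⁻¹ * g p.2), fun s hs v hv w hw => ?_⟩
  have hf := edge_mem_faces hs hv hw
  obtain ⟨t, ht, a, hta⟩ := h _ hf (Finset.card_le_two.trans (by omega))
  have hmem : ∀ u ∈ ({v, w} : Finset ι), ∃ u' ∈ t, a • u' = u := by
    intro u hu
    rw [hta] at hu
    exact ⟨a⁻¹ • u, by simpa [translate] using hu, by simp⟩
  obtain ⟨v', hv', rfl⟩ := hmem v (by simp)
  obtain ⟨w', hw', rfl⟩ := hmem w (by simp)
  have h1 := Finset.le_sup (s := F) (f := fun p => wordLength S ((g p.1)⁻¹ * g p.2))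
    (b := (v', w')) (Finset.mem_biUnion.2 ⟨t, by simpa using ht, Finset.mk_mem_product hv' hw'⟩)
  simpa [hg, mul_assoc] using h1

end VertexMap

/-! ### From the group to the complex: filling simplices of the group -/

theorem altDiff_map {Γ A B : Type*} [AddCommGroup A] [AddCommGroup B] (φ : A →+ B) {k : ℕ}
    (z : Cochain Γ A k) (x : Fin (k + 2) → Γ) :
    altDiff (fun y => φ (z y)) x = φ (altDiff z x) := by
  simp [altDiff_apply, map_sum, map_zsmul]

section FillMap

variable {Γ ι : Type*} [Group Γ] [MulAction Γ ι] (X : AbstractSimplicialComplex ι) (v₀ : ι)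

/-- An equivariant chain map from the homogeneous bar complex of the group to the simplicial chains
of `X`, built from minimal fillings; it is a chain map in the degrees where `X` is acyclic. Fillings
are chosen for tuples that start at `1` and translated to all others, which makes the map
equivariant. -/
def fillMap : ∀ k, Cochain Γ ((Fin (k + 1) → ι) →₀ ℤ) k
  | 0 => fun x => vertexChain (x 0 • v₀)
  | k + 1 => fun x => translateChain (x 0)
      (minFilling X (altDiff (fillMap k) fun i => (x 0)⁻¹ * x i))

variable {X v₀}

theorem fillMap_mem (hact : IsSimplicialAction Γ X) (k : ℕ) (x : Fin (k + 1) → Γ) :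
    fillMap X v₀ k x ∈ simplicialChains X k := by
  cases k with
  | zero => exact vertexChain_mem _
  | succ k => exact translateChain_mem hact _ (minFilling_mem _)

theorem fillMap_mul_left (γ : Γ) (k : ℕ) (x : Fin (k + 1) → Γ) :
    fillMap X v₀ k (fun i => γ * x i) = translateChain γ (fillMap X v₀ k x) := by
  cases k with
  | zero =>
    simp only [fillMap, vertexChain, translateChain_eq, Finsupp.mapDomain_single, mul_smul]
  | succ k =>
    simp only [fillMap, ← translateChain_mul]
    have h : (fun i => (γ * x 0)⁻¹ * (γ * x i)) = fun i => (x 0)⁻¹ * x i := by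
      funext i
      group
    rw [h]

theorem altDiff_fillMap_mem (hact : IsSimplicialAction Γ X) (k : ℕ) (x : Fin (k + 2) → Γ) :
    altDiff (fillMap X v₀ k) x ∈ simplicialChains X k :=
  sum_mem fun _ _ => zsmul_mem (fillMap_mem hact _ _) _

theorem altDiff_fillMap_mul_left (γ : Γ) (k : ℕ) (x : Fin (k + 2) → Γ) :
    altDiff (fillMap X v₀ k) (fun i => γ * x i) =
      translateChain γ (altDiff (fillMap X v₀ k) x) := by
  rw [← altDiff_map]
  simp only [altDiff_apply, ← fillMap_mul_left]

theorem altDiff_fillMap_zero (x : Fin 2 → Γ) :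
    altDiff (fillMap X v₀ 0) x = vertexChain (x 1 • v₀) - vertexChain (x 0 • v₀) := by
  simp [altDiff_apply, Fin.sum_univ_two, fillMap, sub_eq_add_neg]

/-- If `X` is connected and its cycles in degrees `1, …, n - 1` bound, then the cycles that occur in
the construction of `fillMap` have fillings, and `fillMap` is a chain map up to degree `n`. -/
theorem exists_filling_altDiff_fillMap (hact : IsSimplicialAction Γ X)
    (hconn : ∀ v w, Joined X v w) {n : ℕ}
    (hex : ∀ m, m + 2 ≤ n → ∀ c ∈ simplicialChains X (m + 1), boundary c = 0 →
      ∃ b, IsFilling X c b) (k : ℕ) (hk : k < n) (x : Fin (k + 2) → Γ) :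
    (∃ b, IsFilling X (altDiff (fillMap X v₀ k) x) b) ∧
      boundary (fillMap X v₀ (k + 1) x) = altDiff (fillMap X v₀ k) x := by
  have key : ∀ y, ∃ b, IsFilling X (altDiff (fillMap (Γ := Γ) X v₀ k) y) b := by
    intro y
    cases k with
    | zero =>
      rw [altDiff_fillMap_zero]
      exact exists_filling_of_joined (hconn _ _)
    | succ k =>
      refine hex k (by omega) _ (altDiff_fillMap_mem hact _ _) ?_
      have h : (fun y => boundary (fillMap X v₀ (k + 1) y)) = altDiff (fillMap (Γ := Γ) X v₀ k) :=
        funext fun y =>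
          (exists_filling_altDiff_fillMap hact hconn hex k (by omega) y).2
      rw [← altDiff_map, h, altDiff_altDiff]
      rfl
  refine ⟨key x, ?_⟩
  rw [fillMap, boundary_translateChain, (isFilling_minFilling (key _)).2,
    ← altDiff_fillMap_mul_left]
  simp

theorem isFilling_vertexChain_zero (v : ι) : IsFilling X (vertexChain v - vertexChain v) 0 :=
  ⟨zero_mem _, by simp⟩

/-- In a connected complex, the `0`-cycle `γ • v₀ - v₀` has a filling of size linear in the length
of `γ`: a path along a word representing `γ`. -/
theorem exists_linear_filling {S : Finset Γ} (hS : Subgroup.closure (S : Set Γ) = ⊤)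
    (hact : IsSimplicialAction Γ X) (hconn : ∀ v w, Joined X v w) :
    ∃ K : ℕ, ∀ γ : Γ, ∃ b, IsFilling X (vertexChain (γ • v₀) - vertexChain v₀) b ∧
      mass b ≤ K * wordLength S γ := by
  choose b hb using fun γ : Γ => exists_filling_of_joined (hconn v₀ (γ • v₀))
  obtain ⟨K, hK⟩ := ((finite_wordLength_le hS 1).image fun γ => mass (b γ)).bddAbove
  have hletter : ∀ γ : Γ, (γ ∈ S ∨ γ⁻¹ ∈ S) → mass (b γ) ≤ K := by
    intro γ hγ
    refine hK ⟨γ, ?_, rfl⟩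
    simpa using wordLength_le_length (S := S) (l := [γ]) (by simpa using hγ)
  have hword : ∀ l : List Γ, (∀ x ∈ l, x ∈ S ∨ x⁻¹ ∈ S) →
      ∃ b, IsFilling X (vertexChain (l.prod • v₀) - vertexChain v₀) b ∧ mass b ≤ K * l.length := by
    intro l
    induction l with
    | nil => exact fun _ => ⟨0, by simpa using isFilling_vertexChain_zero v₀, by simp⟩
    | cons a l ih =>
      intro hl
      obtain ⟨b', hb', hm⟩ := ih fun x hx => hl x (List.mem_cons_of_mem _ hx)
      have ha := hletter a (hl a List.mem_cons_self)
      refine ⟨b a + translateChain a b',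
        ⟨add_mem (hb a).1 (translateChain_mem hact a hb'.1), ?_⟩, ?_⟩
      · rw [map_add, boundary_translateChain, (hb a).2, hb'.2, map_sub]
        simp only [vertexChain, translateChain_eq, Finsupp.mapDomain_single, List.prod_cons,
          mul_smul]
        abel
      · refine (mass_add_le _ _).trans ?_
        rw [mass_translateChain, List.length_cons]
        linarith
  refine ⟨K, fun γ => ?_⟩
  obtain ⟨l, h1, h2, rfl⟩ := exists_word hS γ
  rw [← h1]
  exact hword l h2

end FillMap

/-! ### Polynomial control of the fillings -/

section Control

variable {Γ ι : Type*} [Group Γ]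

/-- The family of chains `f` is controlled with exponent `A`: the mass of `f x` and the distance of
the images of its vertices under `g` from `x 0` are bounded by a multiple of `(spread x) ^ A`. -/
def Controlled (S : Finset Γ) (g : ι → Γ) (A : ℝ) {k : ℕ}
    (f : Cochain Γ ((Fin (k + 1) → ι) →₀ ℤ) k) : Prop :=
  ∃ K : ℝ, 0 ≤ K ∧ ∀ x, (mass (f x) : ℝ) ≤ K * (spread S x : ℝ) ^ A ∧
    ∀ τ ∈ (f x).support, ∀ i, (wordLength S ((x 0)⁻¹ * g (τ i)) : ℝ) ≤ K * (spread S x : ℝ) ^ A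

theorem one_le_spread_real {S : Finset Γ} {k : ℕ} (x : Fin (k + 1) → Γ) : (1 : ℝ) ≤ spread S x := by
  exact_mod_cast one_le_spread x

theorem Controlled.mono {S : Finset Γ} {g : ι → Γ} {A B : ℝ} {k : ℕ}
    {f : Cochain Γ ((Fin (k + 1) → ι) →₀ ℤ) k} (h : Controlled S g A f) (hAB : A ≤ B) :
    Controlled S g B f := by
  obtain ⟨K, hK, h⟩ := h
  have h1 : ∀ x : Fin (k + 1) → Γ, K * (spread S x : ℝ) ^ A ≤ K * (spread S x : ℝ) ^ B := fun x =>
    mul_le_mul_of_nonneg_left (Real.rpow_le_rpow_of_exponent_le (one_le_spread_real x) hAB) hK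
  exact ⟨K, hK, fun x => ⟨(h x).1.trans (h1 x), fun τ hτ i => ((h x).2 τ hτ i).trans (h1 x)⟩⟩

variable [MulAction Γ ι] {X : AbstractSimplicialComplex ι} {v₀ : ι} {S : Finset Γ}
  {g : ι → Γ}

theorem controlled_fillMap_zero (hg : ∀ (γ : Γ) (v : ι), g (γ • v) = γ * g v) :
    Controlled S g 1 (fillMap X v₀ 0) := by
  refine ⟨1 + wordLength S (g v₀), by positivity, fun x => ⟨?_, fun τ hτ i => ?_⟩⟩
  · have := one_le_spread_real (S := S) x
    simp only [fillMap, vertexChain, mass_single]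
    rw [Real.rpow_one]
    push_cast
    nlinarith [(wordLength S (g v₀)).cast_nonneg (α := ℝ)]
  · have h := Finsupp.support_single_subset hτ
    rw [Finset.mem_singleton] at h
    rw [h, hg, Real.rpow_one]
    have := one_le_spread_real (S := S) x
    simp only [inv_mul_cancel_left]
    nlinarith [(wordLength S (g v₀)).cast_nonneg (α := ℝ)]

theorem mass_altDiff_fillMap_le {A K : ℝ} (hA : 0 ≤ A) (hK : 0 ≤ K) {k : ℕ}
    (h : ∀ x : Fin (k + 1) → Γ, (mass (fillMap X v₀ k x) : ℝ) ≤ K * (spread S x : ℝ) ^ A)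
    (y : Fin (k + 2) → Γ) :
    (mass (altDiff (fillMap X v₀ k) y) : ℝ) ≤ (k + 2) * K * (spread S y : ℝ) ^ A := by
  have h1 : (mass (altDiff (fillMap X v₀ k) y) : ℝ) ≤
      ∑ i : Fin (k + 2), (mass (fillMap X v₀ k fun j => y (i.succAbove j)) : ℝ) := by
    have := mass_sum_le Finset.univ fun i : Fin (k + 2) =>
      (-1 : ℤ) ^ (i : ℕ) • fillMap X v₀ k fun j => y (i.succAbove j)
    simp only [mass_neg_one_pow_smul] at this
    exact_mod_cast this
  refine h1.trans ((Finset.sum_le_card_nsmul _ _ (K * (spread S y : ℝ) ^ A) fun i _ => ?_).trans ?_)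
  · refine (h _).trans (mul_le_mul_of_nonneg_left (Real.rpow_le_rpow (by positivity) ?_ hA) hK)
    exact_mod_cast spread_comp_le y _
  · simp [mul_assoc]

/-- Minimal fillings of polynomial mass stay polynomially close to the base point. -/
theorem controlled_fillMap_succ (hS : Subgroup.closure (S : Set Γ) = ⊤)
    (hg : ∀ (γ : Γ) (v : ι), g (γ • v) = γ * g v) {D : ℕ}
    (hD : ∀ s ∈ X.faces, ∀ v ∈ s, ∀ w ∈ s, wordLength S ((g v)⁻¹ * g w) ≤ D) {k : ℕ} {A B K : ℝ}
    (hA : 1 ≤ A) (hAB : A ≤ B) (hf : Controlled S g A (fillMap X v₀ k)) (hK : 0 ≤ K)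
    (hfill : ∀ y : Fin (k + 2) → Γ, ∃ b, IsFilling X (altDiff (fillMap X v₀ k) y) b)
    (hmass : ∀ y : Fin (k + 2) → Γ, y 0 = 1 →
      (mass (minFilling X (altDiff (fillMap X v₀ k) y)) : ℝ) ≤ K * (spread S y : ℝ) ^ B) :
    Controlled S g B (fillMap X v₀ (k + 1)) := by
  obtain ⟨K₀, hK₀, hf⟩ := hf
  have hB : 1 ≤ B := hA.trans hAB
  refine ⟨K + (D * K + K₀ + 1), by positivity, fun x => ?_⟩
  set y : Fin (k + 2) → Γ := fun i => (x 0)⁻¹ * x i with hy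
  have hy0 : y 0 = 1 := by simp [hy]
  have hsp : spread S y = spread S x := spread_mul_left _ _
  have hm := hmass y hy0
  have hs1 := one_le_spread_real (S := S) y
  have hpow : (1 : ℝ) ≤ (spread S y : ℝ) ^ B := Real.one_le_rpow hs1 (by linarith)
  rw [← hsp]
  refine ⟨?_, fun τ hτ i => ?_⟩
  · rw [fillMap, mass_translateChain]
    refine hm.trans (mul_le_mul_of_nonneg_right ?_ (by positivity))
    have : 0 ≤ D * K + K₀ + 1 := by positivity
    linarith
  · rw [fillMap, mem_support_translateChain] at hτ
    have hb := isFilling_minFilling (hfill y)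
    obtain ⟨σ, hσ, h1⟩ := exists_near_of_minimal hS hD hb.1
      (fun b' hb' => mass_minFilling_le (by rwa [hb.2] at hb')) hτ i
    rw [hb.2] at hσ
    -- A simplex of the cycle lies in the chain assigned to one of the faces of `y`.
    obtain ⟨j, hj⟩ : ∃ j : Fin (k + 2),
        σ ∈ (fillMap X v₀ k fun l => y (j.succAbove l)).support := by
      by_contra! h
      refine Finsupp.mem_support_iff.1 hσ ?_
      rw [altDiff_apply, Finsupp.finsetSum_apply]
      refine Finset.sum_eq_zero fun j _ => ?_
      simp [Finsupp.notMem_support_iff.1 (h j)]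
    have h2 := (hf _).2 σ hj 0
    have h3 : (spread S (fun l => y (j.succAbove l)) : ℝ) ^ A ≤ (spread S y : ℝ) ^ B :=
      (Real.rpow_le_rpow (by positivity) (by exact_mod_cast spread_comp_le y _)
        (by linarith)).trans (Real.rpow_le_rpow_of_exponent_le hs1 hAB)
    have h4 := wordLength_dist_le_spread (S := S) y 0 (j.succAbove 0)
    have h5 := wordLength_dist_triangle hS (y 0) (y (j.succAbove 0)) (g (σ 0))
    have h6 := wordLength_dist_triangle hS (y 0) (g (σ 0)) (g ((x 0)⁻¹ • τ i))
    have h7 : (y 0)⁻¹ * g ((x 0)⁻¹ • τ i) = (x 0)⁻¹ * g (τ i) := by simp [hg, hy0]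
    rw [h7] at h6
    have h8 : (spread S y : ℝ) ≤ (spread S y : ℝ) ^ B := Real.self_le_rpow_of_one_le hs1 hB
    have h9 : K₀ * (spread S (fun l => y (j.succAbove l)) : ℝ) ^ A ≤ K₀ * (spread S y : ℝ) ^ B :=
      mul_le_mul_of_nonneg_left h3 hK₀
    have h10 : (D : ℝ) * mass (minFilling X (altDiff (fillMap X v₀ k) y)) ≤
        D * (K * (spread S y : ℝ) ^ B) := mul_le_mul_of_nonneg_left hm (by positivity)
    have h11 : 0 ≤ K * (spread S y : ℝ) ^ B := by positivity
    have h12 : (wordLength S ((x 0)⁻¹ * g (τ i)) : ℝ) ≤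
        spread S y + wordLength S ((y (j.succAbove 0))⁻¹ * g (σ 0)) +
          D * mass (minFilling X (altDiff (fillMap X v₀ k) y)) := by
      exact_mod_cast h6.trans (Nat.add_le_add (h5.trans (Nat.add_le_add_right h4 _)) h1)
    linarith

theorem controlled_fillMap_one (hS : Subgroup.closure (S : Set Γ) = ⊤)
    (hact : IsSimplicialAction Γ X) (hg : ∀ (γ : Γ) (v : ι), g (γ • v) = γ * g v) {D : ℕ}
    (hD : ∀ s ∈ X.faces, ∀ v ∈ s, ∀ w ∈ s, wordLength S ((g v)⁻¹ * g w) ≤ D)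
    (hconn : ∀ v w, Joined X v w) : Controlled S g 1 (fillMap X v₀ 1) := by
  obtain ⟨K, hK⟩ := exists_linear_filling (v₀ := v₀) hS hact hconn
  refine controlled_fillMap_succ (K := K) hS hg hD le_rfl le_rfl (controlled_fillMap_zero hg)
    (by positivity) (fun y => ?_) fun y hy => ?_
  · rw [altDiff_fillMap_zero]
    exact exists_filling_of_joined (hconn _ _)
  · obtain ⟨b, hb, hm⟩ := hK (y 1)
    have h1 := wordLength_dist_le_spread (S := S) y 0 1
    rw [hy, inv_one, one_mul] at h1
    have h2 : mass (minFilling X (altDiff (fillMap X v₀ 0) y)) ≤ K * spread S y :=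
      (mass_minFilling_le (by rwa [altDiff_fillMap_zero, hy, one_smul])).trans
        (hm.trans (Nat.mul_le_mul_left _ h1))
    rw [Real.rpow_one]
    exact_mod_cast h2

/-- The filling function is bounded by a multiple of `t ^ a`, with `a ≥ 1`. -/
def HasFillingExponent (X : AbstractSimplicialComplex ι) (j : ℕ) (a : ℝ) : Prop :=
  1 ≤ a ∧ ∃ K : ℝ, 0 ≤ K ∧ ∀ n : ℕ, 0 < n → cFV X j n ≤ ENNReal.ofReal (K * (n : ℝ) ^ a)

theorem HasFillingExponent.exists_filling {m : ℕ} {a : ℝ} (h : HasFillingExponent X (m + 2) a) :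
    ∃ K : ℝ, 0 ≤ K ∧ ∀ c ∈ simplicialChains X (m + 1), boundary c = 0 →
      ∃ b, IsFilling X c b ∧ (mass b : ℝ) ≤ K * ((mass c : ℝ) + 1) ^ a := by
  obtain ⟨ha, K, hK, h⟩ := h
  refine ⟨(m + 3).factorial * (K + 1), by positivity, fun c hc hc0 => ?_⟩
  obtain ⟨b, hb, hm⟩ := exists_filling_of_cFV_lt hc hc0 (Nat.le_succ _) (by positivity)
    (h (mass c + 1) (Nat.succ_pos _))
  refine ⟨b, hb, hm.trans ?_⟩
  push_cast
  have : (1 : ℝ) ≤ ((mass c : ℝ) + 1) ^ a :=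
    Real.one_le_rpow (by linarith [(mass c).cast_nonneg (α := ℝ)]) (by linarith)
  rw [mul_assoc]
  refine mul_le_mul_of_nonneg_left ?_ (by positivity)
  linarith

theorem HasFillingExponent.cycles_bound {m : ℕ} {a : ℝ} (h : HasFillingExponent X (m + 2) a) :
    ∀ c ∈ simplicialChains X (m + 1), boundary c = 0 → ∃ b, IsFilling X c b := by
  obtain ⟨K, -, h⟩ := h.exists_filling
  exact fun c hc hc0 => (h c hc hc0).imp fun _ hb => hb.1

theorem one_le_prod_Icc {a : ℕ → ℝ} {n : ℕ} (h : ∀ j, 2 ≤ j → j ≤ n → 1 ≤ a j) {k : ℕ}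
    (hk : k ≤ n) : 1 ≤ ∏ j ∈ Finset.Icc 2 k, a j := by
  rw [← Finset.prod_const_one (s := Finset.Icc 2 k)]
  refine Finset.prod_le_prod (fun _ _ => zero_le_one) fun j hj => ?_
  rw [Finset.mem_Icc] at hj
  exact h j hj.1 (hj.2.trans hk)

theorem prod_Icc_mono {a : ℕ → ℝ} {n : ℕ} (h : ∀ j, 2 ≤ j → j ≤ n → 1 ≤ a j) {k l : ℕ}
    (hkl : k ≤ l) (hl : l ≤ n) : ∏ j ∈ Finset.Icc 2 k, a j ≤ ∏ j ∈ Finset.Icc 2 l, a j := by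
  induction l, hkl using Nat.le_induction with
  | base => rfl
  | succ l hkl ih =>
    refine (ih (by omega)).trans ?_
    rcases Nat.lt_or_ge (l + 1) 2 with h2 | h2
    · rw [Finset.Icc_eq_empty (by omega), Finset.Icc_eq_empty (by omega)]
    · rw [Finset.prod_Icc_succ_top h2]
      exact le_mul_of_one_le_right (by linarith [one_le_prod_Icc h (by omega : l ≤ n)]) (h _ h2 hl)

/-- The exponents of the filling functions multiply. -/
theorem controlled_fillMap (hS : Subgroup.closure (S : Set Γ) = ⊤)
    (hact : IsSimplicialAction Γ X) (hg : ∀ (γ : Γ) (v : ι), g (γ • v) = γ * g v) {D : ℕ}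
    (hD : ∀ s ∈ X.faces, ∀ v ∈ s, ∀ w ∈ s, wordLength S ((g v)⁻¹ * g w) ≤ D)
    (hconn : ∀ v w, Joined X v w) {n : ℕ} {a : ℕ → ℝ}
    (ha : ∀ j, 2 ≤ j → j ≤ n → HasFillingExponent X j (a j)) (k : ℕ) (hk : k ≤ n) :
    Controlled S g (∏ j ∈ Finset.Icc 2 k, a j) (fillMap X v₀ k) := by
  match k with
  | 0 => simpa using controlled_fillMap_zero (X := X) (v₀ := v₀) (S := S) hg
  | 1 => simpa using controlled_fillMap_one (v₀ := v₀) hS hact hg hD hconn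
  | m + 2 =>
    have ih := controlled_fillMap hS hact hg hD hconn ha (m + 1) (by omega)
    set A := ∏ j ∈ Finset.Icc 2 (m + 1), a j with hA
    have hA1 : 1 ≤ A := one_le_prod_Icc (fun j h1 h2 => (ha j h1 h2).1) (by omega : m + 1 ≤ n)
    have ha1 : 1 ≤ a (m + 2) := (ha _ (by omega) hk).1
    rw [Finset.prod_Icc_succ_top (by omega), ← hA]
    obtain ⟨K, hK, hfill⟩ := (ha (m + 2) (by omega) hk).exists_filling
    have hchain := exists_filling_altDiff_fillMap (Γ := Γ) (v₀ := v₀) hact hconn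
      fun m hm => (ha (m + 2) (by omega) hm).cycles_bound
    obtain ⟨K₀, hK₀, hf⟩ := id ih
    have hKK : 0 ≤ (m + 3) * K₀ + 1 := by positivity
    refine controlled_fillMap_succ (K := K * ((m + 3) * K₀ + 1) ^ a (m + 2)) hS hg hD hA1
      (le_mul_of_one_le_right (by linarith) ha1) ih (by positivity)
      (fun y => (hchain (m + 1) (by omega) y).1) fun y _ => ?_
    have hcycle : boundary (altDiff (fillMap X v₀ (m + 1)) y) = 0 := by
      have h : (fun y => boundary (fillMap X v₀ (m + 1) y)) = altDiff (fillMap (Γ := Γ) X v₀ m) :=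
        funext fun y => (hchain m (by omega) y).2
      rw [← altDiff_map, h, altDiff_altDiff]
      rfl
    obtain ⟨b, hb, hm⟩ := hfill _ (altDiff_fillMap_mem hact _ y) hcycle
    have h1 := mass_altDiff_fillMap_le (S := S) (by linarith) hK₀ (fun x => (hf x).1) y
    have hs := one_le_spread_real (S := S) y
    have h2 : (1 : ℝ) ≤ (spread S y : ℝ) ^ A := Real.one_le_rpow hs (by linarith)
    calc (mass (minFilling X (altDiff (fillMap X v₀ (m + 1)) y)) : ℝ) ≤ mass b := by
          exact_mod_cast mass_minFilling_le hb
      _ ≤ K * ((mass (altDiff (fillMap X v₀ (m + 1)) y) : ℝ) + 1) ^ a (m + 2) := hm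
      _ ≤ K * (((m + 3) * K₀ + 1) * (spread S y : ℝ) ^ A) ^ a (m + 2) := by
          refine mul_le_mul_of_nonneg_left
            (Real.rpow_le_rpow (by positivity) ?_ (by linarith)) hK
          push_cast at h1
          linarith
      _ = _ := by
          rw [Real.mul_rpow hKK (by positivity), ← Real.rpow_mul (by positivity)]
          ring

end Control

/-! ### The operator on cochains induced by filling -/

theorem coboundary_eq_altDiff {Γ : Type*} (𝕜 : Type*) [RCLike 𝕜] {V : Type*}
    [NormedAddCommGroup V] [NormedSpace 𝕜 V] {k : ℕ} (z : Cochain Γ V k) :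
    coboundary Γ 𝕜 V k z = altDiff z := by
  funext x
  change ∑ i : Fin (k + 2), (-1 : 𝕜) ^ (i : ℕ) • z (fun j => x (i.succAbove j)) = _
  rw [altDiff_apply]
  refine Finset.sum_congr rfl fun i _ => ?_
  rcases Nat.even_or_odd (i : ℕ) with h | h <;> simp [h.neg_one_pow]

section FillOp

variable {Γ ι : Type*} [Group Γ] [MulAction Γ ι] (𝕜 : Type*) [RCLike 𝕜] {V : Type*}
  [NormedAddCommGroup V] [NormedSpace 𝕜 V]

variable (X : AbstractSimplicialComplex ι) (v₀ : ι) (g : ι → Γ)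

/-- The operator on cochains dual to the composition of `fillMap`, from the group to the complex,
with the map induced by `g`, from the complex back to the group. -/
def fillOp (k : ℕ) : Cochain Γ V k →ₗ[𝕜] Cochain Γ V k where
  toFun z x := pairing 𝕜 g z (fillMap X v₀ k x)
  map_add' z w := by
    funext x
    simp only [pairing_apply, Pi.add_apply, smul_add, Finsupp.sum_add]
  map_smul' r z := by
    funext x
    simp only [pairing_apply, Pi.smul_apply, RingHom.id_apply, Finsupp.sum, Finset.smul_sum]
    refine Finset.sum_congr rfl fun τ _ => ?_
    rw [smul_comm _ r, smul_comm _ r]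

variable {X v₀ g}

theorem fillOp_apply {k : ℕ} (z : Cochain Γ V k) (x : Fin (k + 1) → Γ) :
    fillOp 𝕜 X v₀ g k z x = pairing 𝕜 g z (fillMap X v₀ k x) := rfl

theorem fillOp_altDiff (hact : IsSimplicialAction Γ X) {k : ℕ}
    (h : ∀ x : Fin (k + 2) → Γ, boundary (fillMap X v₀ (k + 1) x) = altDiff (fillMap X v₀ k) x)
    (z : Cochain Γ V k) :
    fillOp 𝕜 X v₀ g (k + 1) (altDiff z) = altDiff (fillOp 𝕜 X v₀ g k z) := by
  funext x
  rw [fillOp_apply, pairing_altDiff 𝕜 g z (fillMap_mem hact _ _), h, ← altDiff_map]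
  rfl

theorem fillOp_const (v : V) :
    fillOp 𝕜 X v₀ g 0 (fun _ => v) = fun _ => v := by
  funext x
  simp [fillOp_apply, pairing_apply, fillMap, vertexChain]

theorem continuous_fillOp (k : ℕ) :
    Continuous (fillOp (V := V) 𝕜 X v₀ g k) := by
  refine continuous_pi fun x => ?_
  change Continuous fun z : Cochain Γ V k => pairing 𝕜 g z (fillMap X v₀ k x)
  simp only [pairing_apply, Finsupp.sum]
  fun_prop

variable {𝕜} (ρ : Γ →* (V ≃ₗᵢ[𝕜] V))

theorem fillOp_translate (hg : ∀ (γ : Γ) (v : ι), g (γ • v) = γ * g v) {k : ℕ} {γ : Γ}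
    {z w : Cochain Γ V k} (h : ∀ y, w (fun i => γ * y i) = ρ γ (z y)) (x : Fin (k + 1) → Γ) :
    fillOp 𝕜 X v₀ g k w (fun i => γ * x i) = ρ γ (fillOp 𝕜 X v₀ g k z x) := by
  rw [fillOp_apply, fillOp_apply, fillMap_mul_left, pairing_apply, pairing_apply,
    translateChain_eq, Finsupp.sum_mapDomain_index (by simp) (by simp [add_smul])]
  simp only [hg, Finsupp.sum, map_smul, map_sum, map_zsmul]
  congr 1
  exact Finset.sum_congr rfl fun τ _ => by rw [h]

theorem altDiff_translate {k : ℕ} {γ : Γ} {z w : Cochain Γ V k}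
    (h : ∀ y, w (fun i => γ * y i) = ρ γ (z y)) (x : Fin (k + 2) → Γ) :
    altDiff w (fun i => γ * x i) = ρ γ (altDiff z x) := by
  simp [altDiff_apply, map_sum, map_zsmul, h]

theorem cone_translate {k : ℕ} {γ : Γ} {z w : Cochain Γ V (k + 1)}
    (h : ∀ y, w (fun i => γ * y i) = ρ γ (z y)) (a : Γ) (x : Fin (k + 1) → Γ) :
    cone (γ * a) w (fun i => γ * x i) = ρ γ (cone a z x) := by
  rw [cone_apply, cone_apply, ← h]
  congr 1
  funext i
  refine Fin.cases ?_ (fun i => ?_) i <;> simp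

variable (𝕜 X v₀ g) in
/-- The homotopy between `fillOp` and the identity. -/
def fillHomotopy (k : ℕ) : Cochain Γ V (k + 1) → Cochain Γ V k :=
  coneHomotopy (fun k => (fillOp 𝕜 X v₀ g k).toAddMonoidHom) k

theorem fillHomotopy_zero_apply (z : Cochain Γ V 1) (x : Fin 1 → Γ) :
    fillHomotopy 𝕜 X v₀ g 0 z x = fillOp 𝕜 X v₀ g 0 (cone (x 0) z) x - cone (x 0) z x := rfl

theorem fillHomotopy_succ_apply {k : ℕ} (z : Cochain Γ V (k + 2)) (x : Fin (k + 2) → Γ) :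
    fillHomotopy 𝕜 X v₀ g (k + 1) z x = fillOp 𝕜 X v₀ g (k + 1) (cone (x 0) z) x -
      cone (x 0) z x - altDiff (fillHomotopy 𝕜 X v₀ g k (cone (x 0) z)) x := rfl

theorem fillHomotopy_translate (hg : ∀ (γ : Γ) (v : ι), g (γ • v) = γ * g v) {k : ℕ} {γ : Γ}
    {z w : Cochain Γ V (k + 1)} (h : ∀ y, w (fun i => γ * y i) = ρ γ (z y))
    (x : Fin (k + 1) → Γ) :
    fillHomotopy 𝕜 X v₀ g k w (fun i => γ * x i) = ρ γ (fillHomotopy 𝕜 X v₀ g k z x) := by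
  induction k with
  | zero =>
    rw [fillHomotopy_zero_apply, fillHomotopy_zero_apply, map_sub,
      fillOp_translate ρ hg (cone_translate ρ h _), cone_translate ρ h]
  | succ k ih =>
    rw [fillHomotopy_succ_apply, fillHomotopy_succ_apply, map_sub, map_sub,
      fillOp_translate ρ hg (cone_translate ρ h _), cone_translate ρ h,
      altDiff_translate ρ (ih (cone_translate ρ h _))]

/-- On cocycles, `fillOp` and the identity differ by the coboundary of `fillHomotopy`. -/
theorem altDiff_fillHomotopy (hact : IsSimplicialAction Γ X) {n : ℕ}
    (h : ∀ k < n, ∀ x : Fin (k + 2) → Γ,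
      boundary (fillMap X v₀ (k + 1) x) = altDiff (fillMap X v₀ k) x) {k : ℕ} (hk : k < n)
    {z : Cochain Γ V (k + 1)} (hz : altDiff z = 0) :
    altDiff (fillHomotopy 𝕜 X v₀ g k z) = fillOp 𝕜 X v₀ g (k + 1) z - z := by
  have h1 := altDiff_coneHomotopy_add
    (fun k => (fillOp (V := V) 𝕜 X v₀ g k).toAddMonoidHom)
    (fun v => fillOp_const (X := X) (v₀ := v₀) (g := g) 𝕜 v)
    (fun k hk z => fillOp_altDiff 𝕜 hact (h k hk) z) k hk z
  have h2 : coneHomotopy (fun k => (fillOp (V := V) 𝕜 X v₀ g k).toAddMonoidHom) (k + 1) 0 = 0 := by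
    simpa using coneHomotopy_sub (fun k => (fillOp (V := V) 𝕜 X v₀ g k).toAddMonoidHom) (k + 1) 0 0
  rw [hz, h2, add_zero] at h1
  exact h1

end FillOp

/-! ### Polynomial growth of the operators -/

section Estimates

variable {Γ ι : Type*} [Group Γ] [MulAction Γ ι] {𝕜 : Type*} [RCLike 𝕜] {V : Type*}
  [NormedAddCommGroup V] [NormedSpace 𝕜 V] {X : AbstractSimplicialComplex ι} {v₀ : ι} {g : ι → Γ}
  {S : Finset Γ} {ρ : Γ →* (V ≃ₗᵢ[𝕜] V)}

theorem one_le_size {k : ℕ} (x : Fin (k + 1) → Γ) :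
    (1 : ℝ) ≤ 1 + ∑ i, (wordLength S (x i) : ℝ) := by
  have : 0 ≤ ∑ i, (wordLength S (x i) : ℝ) := by positivity
  linarith

variable (𝕜 V S) in
theorem polynomialCochains_mono {M N : ℝ} (h : N ≤ M) (k : ℕ) :
    polynomialCochains (Γ := Γ) 𝕜 V S N k ≤ polynomialCochains 𝕜 V S M k := by
  rintro c ⟨C, hC⟩
  refine ⟨|C|, fun x => (hC x).trans ?_⟩
  have h1 := one_le_size (S := S) x
  exact mul_le_mul (le_abs_self C) (Real.rpow_le_rpow_of_exponent_le h1 h) (by positivity)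
    (abs_nonneg C)

theorem mem_polynomialCochains_of_spread (hS : Subgroup.closure (S : Set Γ) = ⊤) {A K : ℝ}
    (hA : 0 ≤ A) (hK : 0 ≤ K) {k : ℕ} {z : Cochain Γ V k}
    (h : ∀ x, ‖z x‖ ≤ K * (spread S x : ℝ) ^ A) : z ∈ polynomialCochains 𝕜 V S A k := by
  refine ⟨K * 2 ^ A, fun x => (h x).trans ?_⟩
  rw [mul_assoc, ← Real.mul_rpow (by positivity) (by positivity)]
  refine mul_le_mul_of_nonneg_left (Real.rpow_le_rpow (by positivity) ?_ hA) hK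
  exact_mod_cast spread_le hS x

theorem norm_eq_of_equivariant {k : ℕ} {z : Cochain Γ V k} (hz : z ∈ equivariantCochains ρ k)
    (γ : Γ) (x : Fin (k + 1) → Γ) : ‖z fun i => γ * x i‖ = ‖z x‖ := by
  rw [hz γ x, LinearIsometryEquiv.norm_map]

/-- An equivariant cochain is bounded on tuples of bounded diameter, since these form finitely many
orbits. -/
theorem exists_bound_of_spread_le (hS : Subgroup.closure (S : Set Γ) = ⊤) {k : ℕ}
    {z : Cochain Γ V k} (hz : z ∈ equivariantCochains ρ k) (R : ℕ) :
    ∃ B : ℝ, 0 ≤ B ∧ ∀ x, spread S x ≤ R → ‖z x‖ ≤ B := by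
  have hfin : {x : Fin (k + 1) → Γ | ∀ i, wordLength S (x i) ≤ R}.Finite := by
    have := Set.Finite.pi' fun _ : Fin (k + 1) => finite_wordLength_le hS R
    exact this
  obtain ⟨B, hB⟩ := (hfin.image fun x => ‖z x‖).bddAbove
  refine ⟨max B 0, le_max_right _ _, fun x hx => ?_⟩
  rw [← norm_eq_of_equivariant hz (x 0)⁻¹]
  exact (hB ⟨_, fun i => (wordLength_dist_le_spread x 0 i).trans hx, rfl⟩).trans (le_max_left _ _)

theorem fillOp_mem (hS : Subgroup.closure (S : Set Γ) = ⊤) (hact : IsSimplicialAction Γ X)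
    (hg : ∀ (γ : Γ) (v : ι), g (γ • v) = γ * g v) {D : ℕ}
    (hD : ∀ s ∈ X.faces, ∀ v ∈ s, ∀ w ∈ s, wordLength S ((g v)⁻¹ * g w) ≤ D) {k : ℕ} {A : ℝ}
    (hA : 0 ≤ A) (hf : Controlled S g A (fillMap X v₀ k)) {z : Cochain Γ V k}
    (hz : z ∈ equivariantCochains ρ k) :
    fillOp 𝕜 X v₀ g k z ∈ polEquivariantCochains ρ S A k := by
  refine ⟨fun γ x => fillOp_translate ρ hg (hz γ) x, ?_⟩
  obtain ⟨K, hK, hf⟩ := hf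
  obtain ⟨B, hB, hzB⟩ := exists_bound_of_spread_le hS hz (1 + D)
  refine mem_polynomialCochains_of_spread hS hA (K := K * B) (by positivity) fun x => ?_
  refine (norm_pairing_le 𝕜 g z _ (B := B) fun τ hτ => hzB _ ?_).trans ?_
  · obtain ⟨s, hs, h⟩ := exists_face_of_mem_support (fillMap_mem hact k x) hτ
    exact Nat.add_le_add_left (Finset.sup_le fun p _ => hD s hs _ (h _) _ (h _)) 1
  · rw [mul_right_comm]
    exact mul_le_mul_of_nonneg_right (hf x).1 hB

/-- The value at `x` of the homotopy is a combination of at most `K * (spread x) ^ A` values of the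
cochain, at tuples in the ball of radius `K * (spread x) ^ A` around `x 0`. -/
theorem exists_fillHomotopy_bound (hS : Subgroup.closure (S : Set Γ) = ⊤) {A : ℝ} (hA : 1 ≤ A)
    (k : ℕ) (hf : ∀ j ≤ k, Controlled S g A (fillMap X v₀ j)) :
    ∃ K : ℝ, 0 ≤ K ∧ ∀ (x : Fin (k + 1) → Γ) (z : Cochain Γ V (k + 1)) (B : ℝ), 0 ≤ B →
      (∀ y, (∀ i, (wordLength S ((x 0)⁻¹ * y i) : ℝ) ≤ K * (spread S x : ℝ) ^ A) → ‖z y‖ ≤ B) →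
        ‖fillHomotopy 𝕜 X v₀ g k z x‖ ≤ K * (spread S x : ℝ) ^ A * B := by
  have hsp : ∀ {k : ℕ} (x : Fin (k + 1) → Γ), (spread S x : ℝ) ≤ (spread S x : ℝ) ^ A := fun x =>
    Real.self_le_rpow_of_one_le (one_le_spread_real x) hA
  -- The terms `P - 1` of the homotopy.
  have main : ∀ j ≤ k, ∃ K : ℝ, 0 ≤ K ∧ ∀ K', K + 1 ≤ K' →
      ∀ (x : Fin (j + 1) → Γ) (z : Cochain Γ V (j + 1)) (B : ℝ), 0 ≤ B →
      (∀ y, (∀ i, (wordLength S ((x 0)⁻¹ * y i) : ℝ) ≤ K' * (spread S x : ℝ) ^ A) → ‖z y‖ ≤ B) →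
        ‖fillOp 𝕜 X v₀ g j (cone (x 0) z) x - cone (x 0) z x‖ ≤
          (K + 1) * (spread S x : ℝ) ^ A * B := by
    intro j hj
    obtain ⟨K, hK, h⟩ := hf j hj
    refine ⟨K, hK, fun K' hK' x z B hB hz => ?_⟩
    have hs := one_le_spread_real (S := S) x
    have h0 : 0 ≤ (spread S x : ℝ) ^ A := by positivity
    have hcone : ∀ y : Fin (j + 1) → Γ,
        (∀ i, (wordLength S ((x 0)⁻¹ * y i) : ℝ) ≤ K' * (spread S x : ℝ) ^ A) →
          ‖cone (x 0) z y‖ ≤ B := by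
      intro y hy
      refine hz _ fun i => ?_
      refine Fin.cases ?_ (fun i => ?_) i
      · simp only [Fin.cons_zero, inv_mul_cancel, wordLength_one, Nat.cast_zero]
        have : 0 ≤ K' := by linarith
        positivity
      · simpa using hy i
    have h1 : ‖fillOp 𝕜 X v₀ g j (cone (x 0) z) x‖ ≤ K * (spread S x : ℝ) ^ A * B := by
      refine (norm_pairing_le 𝕜 g _ _ fun τ hτ => hcone _ fun i => ((h x).2 τ hτ i).trans ?_).trans
        (mul_le_mul_of_nonneg_right (h x).1 hB)
      exact mul_le_mul_of_nonneg_right (by linarith) h0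
    have h2 : ‖cone (x 0) z x‖ ≤ B := by
      refine hcone _ fun i => ?_
      have h3 : (wordLength S ((x 0)⁻¹ * x i) : ℝ) ≤ spread S x := by
        exact_mod_cast wordLength_dist_le_spread x 0 i
      have := hsp x
      nlinarith
    have h4 : (1 : ℝ) ≤ (spread S x : ℝ) ^ A := hs.trans (hsp x)
    refine (norm_sub_le _ _).trans ?_
    nlinarith [mul_le_mul_of_nonneg_right h4 hB]
  induction k with
  | zero =>
    obtain ⟨K, hK, h⟩ := main 0 le_rfl
    exact ⟨K + 1, by positivity, fun x z B hB hz => h _ le_rfl x z B hB hz⟩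
  | succ k ih =>
    obtain ⟨K₁, hK₁, ih⟩ := ih (fun j hj => hf j (by omega)) fun j hj => main j (by omega)
    obtain ⟨K, hK, h⟩ := main (k + 1) le_rfl
    refine ⟨K + 1 + (k + 2) * (K₁ + 1), by positivity, fun x z B hB hz => ?_⟩
    have hpos : 0 ≤ (k : ℝ) * (K₁ + 1) := by positivity
    have h1 := h _ (by nlinarith) x z B hB hz
    have h0 : 0 ≤ (spread S x : ℝ) ^ A := by positivity
    have h2 : ∀ i : Fin (k + 2),
        ‖fillHomotopy 𝕜 X v₀ g k (cone (x 0) z) fun j => x (i.succAbove j)‖ ≤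
          K₁ * (spread S x : ℝ) ^ A * B := by
      intro i
      have hle : (spread S (fun j => x (i.succAbove j)) : ℝ) ^ A ≤ (spread S x : ℝ) ^ A :=
        Real.rpow_le_rpow (by positivity) (by exact_mod_cast spread_comp_le x _) (by linarith)
      refine (ih _ _ B hB fun y hy => hz _ fun l => ?_).trans
        (mul_le_mul_of_nonneg_right (mul_le_mul_of_nonneg_left hle hK₁) hB)
      refine Fin.cases ?_ (fun l => ?_) l
      · simp only [Fin.cons_zero, inv_mul_cancel, wordLength_one, Nat.cast_zero]
        positivity
      · have h3 : (wordLength S ((x 0)⁻¹ * y l) : ℝ) ≤ spread S x +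
            wordLength S ((x (i.succAbove 0))⁻¹ * y l) := by
          exact_mod_cast (wordLength_dist_triangle hS (x 0) (x (i.succAbove 0)) (y l)).trans
            (Nat.add_le_add_right (wordLength_dist_le_spread x 0 _) _)
        have h4 := hsp x
        have h5 := hy l
        have h6 := mul_le_mul_of_nonneg_left hle hK₁
        simp only [Fin.cons_succ]
        nlinarith [mul_nonneg hpos h0, mul_nonneg hK h0, mul_nonneg hK₁ h0]
    have h3 : ‖altDiff (fillHomotopy 𝕜 X v₀ g k (cone (x 0) z)) x‖ ≤
        (k + 2) * (K₁ * (spread S x : ℝ) ^ A * B) := by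
      rw [altDiff_apply]
      refine (norm_sum_le _ _).trans ((Finset.sum_le_card_nsmul _ _
        (K₁ * (spread S x : ℝ) ^ A * B) fun i _ => ?_).trans ?_)
      · refine le_trans (le_of_eq ?_) (h2 i)
        rcases neg_one_pow_eq_or ℤ (i : ℕ) with e | e <;> rw [e] <;> simp
      · simp
    rw [fillHomotopy_succ_apply]
    refine (norm_sub_le _ _).trans ((add_le_add h1 h3).trans ?_)
    have h7 : 0 ≤ ((k : ℝ) + 2) * ((spread S x : ℝ) ^ A * B) := by positivity
    linarith

/-- On cochains of growth `N`, the homotopy has growth `(N + 1) * A`: the number of terms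
contributes `A`, and their size contributes `N * A`. -/
theorem fillHomotopy_mem (hS : Subgroup.closure (S : Set Γ) = ⊤)
    (hg : ∀ (γ : Γ) (v : ι), g (γ • v) = γ * g v) {A N : ℝ} (hA : 1 ≤ A) (hN : 0 ≤ N) {k : ℕ}
    (hf : ∀ j ≤ k, Controlled S g A (fillMap X v₀ j)) {z : Cochain Γ V (k + 1)}
    (hz : z ∈ polEquivariantCochains ρ S N (k + 1)) :
    fillHomotopy 𝕜 X v₀ g k z ∈ polEquivariantCochains ρ S ((N + 1) * A) k := by
  obtain ⟨hz, C, hC⟩ := hz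
  refine ⟨fun γ x => fillHomotopy_translate ρ hg (hz γ) x, ?_⟩
  obtain ⟨K, hK, h⟩ := exists_fillHomotopy_bound (𝕜 := 𝕜) (V := V) hS hA k hf
  refine mem_polynomialCochains_of_spread hS (by positivity)
    (K := K * (|C| * (1 + (k + 2) * K) ^ N)) (by positivity) fun x => ?_
  have hs := one_le_spread_real (S := S) x
  have hpow : (1 : ℝ) ≤ (spread S x : ℝ) ^ A := Real.one_le_rpow hs (by linarith)
  have hbound := h x z (|C| * ((1 + (k + 2) * K) ^ N * (spread S x : ℝ) ^ (A * N))) (by positivity)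
    fun y hy => by
      rw [← norm_eq_of_equivariant hz (x 0)⁻¹]
      refine (hC _).trans (mul_le_mul (le_abs_self C) ?_ (by positivity) (abs_nonneg C))
      rw [Real.rpow_mul (by positivity), ← Real.mul_rpow (by positivity) (by positivity)]
      refine Real.rpow_le_rpow (by positivity) ?_ hN
      have h1 := Finset.sum_le_card_nsmul Finset.univ
        (fun i => (wordLength S ((x 0)⁻¹ * y i) : ℝ)) _ fun i _ => hy i
      simp only [Finset.card_univ, Fintype.card_fin, nsmul_eq_mul] at h1
      push_cast at h1
      linarith
  refine hbound.trans (le_of_eq ?_)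
  rw [show (N + 1) * A = A + A * N by ring, Real.rpow_add (by linarith)]
  ring

end Estimates

/-! ### Quotient maps and the comparison maps -/

section Quotients

variable {R M M' : Type*} [Ring R] [AddCommGroup M] [Module R M] [AddCommGroup M'] [Module R M']

theorem mapQ_surjective {p : Submodule R M} {q : Submodule R M'} {i : M →ₗ[R] M'}
    (hi : p ≤ q.comap i) (h : ∀ z, ∃ y, i y - z ∈ q) : Function.Surjective (p.mapQ q i hi) := by
  intro z
  obtain ⟨z, rfl⟩ := q.mkQ_surjective z
  obtain ⟨y, hy⟩ := h z
  exact ⟨p.mkQ y, (Submodule.Quotient.eq q).2 hy⟩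

variable [TopologicalSpace M] [TopologicalSpace M']

theorem continuous_mapQ {p : Submodule R M} {q : Submodule R M'} {i : M →ₗ[R] M'}
    (hi : p ≤ q.comap i) (hc : Continuous i) : Continuous (p.mapQ q i hi) :=
  p.isQuotientMap_mkQ.continuous_iff.2 (q.continuous_mkQ.comp hc)

theorem isHomeomorph_mapQ {p : Submodule R M} {q : Submodule R M'} {i : M →ₗ[R] M'}
    (hi : p ≤ q.comap i) (hic : Continuous i) {r : M' →ₗ[R] M} (hr : q ≤ p.comap r)
    (hrc : Continuous r) (hir : ∀ z, i (r z) - z ∈ q) (hri : ∀ z, r (i z) - z ∈ p) :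
    IsHomeomorph (p.mapQ q i hi) := by
  refine isHomeomorph_iff_exists_inverse.2 ⟨continuous_mapQ hi hic, q.mapQ p r hr,
    fun z => ?_, fun z => ?_, continuous_mapQ hr hrc⟩
  · obtain ⟨z, rfl⟩ := p.mkQ_surjective z
    exact (Submodule.Quotient.eq p).2 (hri z)
  · obtain ⟨z, rfl⟩ := q.mkQ_surjective z
    exact (Submodule.Quotient.eq q).2 (hir z)

end Quotients

section Comparison

variable {Γ : Type*} [Group Γ] {𝕜 : Type*} [RCLike 𝕜] {V : Type*} [NormedAddCommGroup V]
  [NormedSpace 𝕜 V] {ρ : Γ →* (V ≃ₗᵢ[𝕜] V)} {S : Finset Γ} {M N : ℝ} {k : ℕ}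

theorem comparison_surjective (P : Cochain Γ V k →ₗ[𝕜] Cochain Γ V k)
    (h1 : ∀ z ∈ cocycles ρ k, P z ∈ polCocycles ρ S N k)
    (h2 : ∀ z ∈ cocycles ρ k, P z - z ∈ coboundaries ρ k) :
    Function.Surjective (comparison ρ S M N k) ∧ Function.Surjective (comparisonRed ρ S M N k) :=
  ⟨mapQ_surjective _ fun z => ⟨⟨P z, h1 z z.2⟩, h2 z z.2⟩,
    mapQ_surjective _ fun z =>
      ⟨⟨P z, h1 z z.2⟩, Submodule.le_topologicalClosure _ (h2 z z.2)⟩⟩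

theorem comparison_isHomeomorph
    (P : Cochain Γ V k →ₗ[𝕜] Cochain Γ V k) (hP : Continuous P)
    (h1 : ∀ z ∈ cocycles ρ k, P z ∈ polCocycles ρ S N k)
    (h2 : ∀ z ∈ cocycles ρ k, P z - z ∈ coboundaries ρ k)
    (h3 : ∀ z ∈ coboundaries ρ k, P z ∈ polCoboundaries ρ S M N k)
    (h4 : ∀ z ∈ polCocycles ρ S N k, P z - z ∈ polCoboundaries ρ S M N k) :
    IsHomeomorph (comparison ρ S M N k) ∧ IsHomeomorph (comparisonRed ρ S M N k) := by
  let r : cocycles ρ k →ₗ[𝕜] polCocycles ρ S N k := P.restrict h1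
  have hr : Continuous r := (hP.comp continuous_subtype_val).subtype_mk _
  have hi : Continuous (cocycleInclusion ρ S N k) := continuous_subtype_val.subtype_mk _
  have hle : (coboundaries ρ k).submoduleOf (cocycles ρ k) ≤
      ((polCoboundaries ρ S M N k).submoduleOf (polCocycles ρ S N k)).comap r :=
    fun z hz => h3 z hz
  refine ⟨isHomeomorph_mapQ _ hi hle hr (fun z => h2 z z.2) fun z => h4 z z.2,
    isHomeomorph_mapQ _ hi (r := r) ?_ hr
      (fun z => Submodule.le_topologicalClosure _ (h2 z z.2))
      fun z => Submodule.le_topologicalClosure _ (h4 z z.2)⟩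
  refine Submodule.topologicalClosure_minimal _
    (hle.trans (Submodule.comap_mono (Submodule.le_topologicalClosure _))) ?_
  exact (Submodule.isClosed_topologicalClosure _).preimage hr

theorem equivariantCochains_zero_le (hN : 0 ≤ N) :
    equivariantCochains ρ 0 ≤ polynomialCochains 𝕜 V S N 0 := by
  intro z hz
  refine ⟨‖z fun _ => 1‖, fun x => ?_⟩
  have h : x = fun i => x 0 * 1 := by
    funext i
    rw [mul_one, Subsingleton.elim (α := Fin 1) i 0]
  have h1 : ‖z x‖ = ‖z fun _ => 1‖ := by
    conv_lhs => rw [h]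
    exact norm_eq_of_equivariant hz (x 0) fun _ => 1
  rw [h1]
  exact le_mul_of_one_le_right (norm_nonneg _) (Real.one_le_rpow (one_le_size x) hN)

theorem polEquivariantCochains_mono (h : N ≤ M) :
    polEquivariantCochains ρ S N k ≤ polEquivariantCochains ρ S M k :=
  inf_le_inf_left _ (polynomialCochains_mono 𝕜 V S h k)

/-- The comparison maps for given exponents `a j` of the filling functions. For `m = 0` the homotopy
takes values in equivariant `0`-cochains, which are bounded, so no condition on `M` is needed. -/
theorem comparison_of_exponents {ι : Type*} [MulAction Γ ι] {X : AbstractSimplicialComplex ι}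
    (hS : Subgroup.closure (S : Set Γ) = ⊤) (hact : IsSimplicialAction Γ X)
    (hfree : IsFreeAction Γ X) [ContractibleSpace (Realization X)] {d : ℕ} (hd : 1 ≤ d)
    (hcoc : HasCocompactSkeleton Γ X d) {m : ℕ} {a : ℕ → ℝ}
    (ha : ∀ j, 2 ≤ j → j ≤ m + 1 → HasFillingExponent X j (a j))
    (hN : ∏ j ∈ Finset.Icc 2 (m + 1), a j ≤ N) (hNM : N ≤ M) :
    (Function.Surjective (comparison ρ S M N (m + 1)) ∧
      Function.Surjective (comparisonRed ρ S M N (m + 1))) ∧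
    ((1 ≤ m → (N + 1) * ∏ j ∈ Finset.Icc 2 m, a j ≤ M) →
      IsHomeomorph (comparison ρ S M N (m + 1)) ∧
      IsHomeomorph (comparisonRed ρ S M N (m + 1))) := by
  obtain ⟨x₀⟩ : Nonempty (Realization X) := inferInstance
  obtain ⟨v₀, -⟩ := Realization.support_nonempty x₀
  obtain ⟨g, hg⟩ := exists_equivariant_vertexMap hfree
  obtain ⟨D, hD⟩ := exists_edge_bound S hd hcoc hg
  have hconn : ∀ v w, Joined X v w := joined_of_preconnectedSpace
  have ha1 : ∀ j, 2 ≤ j → j ≤ m + 1 → 1 ≤ a j := fun j h1 h2 => (ha j h1 h2).1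
  have hcontrol := controlled_fillMap (v₀ := v₀) hS hact hg hD hconn ha
  have hchain : ∀ k < m + 1, ∀ x : Fin (k + 2) → Γ,
      boundary (fillMap X v₀ (k + 1) x) = altDiff (fillMap X v₀ k) x :=
    fun k hk x => (exists_filling_altDiff_fillMap hact hconn
      (fun j hj => (ha (j + 2) (by omega) hj).cycles_bound) k hk x).2
  have hprod : ∀ k ≤ m + 1, 1 ≤ ∏ j ∈ Finset.Icc 2 k, a j := fun k hk => one_le_prod_Icc ha1 hk
  have hN0 : 0 ≤ N := by linarith [hprod (m + 1) le_rfl]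
  let P := fillOp (V := V) 𝕜 X v₀ g (m + 1)
  let Q := fillHomotopy (V := V) 𝕜 X v₀ g m
  have hPQ : ∀ z ∈ cocycles ρ (m + 1), coboundary Γ 𝕜 V m (Q z) = P z - z := by
    intro z hz
    have hz0 : altDiff z = 0 := by
      rw [← coboundary_eq_altDiff 𝕜]
      exact hz.2
    rw [coboundary_eq_altDiff]
    exact altDiff_fillHomotopy hact hchain (Nat.lt_succ_self m) hz0
  have hQ : ∀ z ∈ equivariantCochains ρ (m + 1), Q z ∈ equivariantCochains ρ m :=
    fun z hz γ x => fillHomotopy_translate ρ hg (hz γ) x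
  have hP : ∀ z ∈ equivariantCochains ρ (m + 1), P z ∈ polEquivariantCochains ρ S N (m + 1) :=
    fun z hz => polEquivariantCochains_mono hN (fillOp_mem hS hact hg hD
      (by linarith [hprod (m + 1) le_rfl]) (hcontrol (m + 1) le_rfl) hz)
  have h2 : ∀ z ∈ cocycles ρ (m + 1), P z - z ∈ coboundaries ρ (m + 1) :=
    fun z hz => ⟨Q z, hQ z hz.1, hPQ z hz⟩
  have hdd : ∀ z : Cochain Γ V m, coboundary Γ 𝕜 V (m + 1) (coboundary Γ 𝕜 V m z) = 0 := by
    intro z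
    rw [coboundary_eq_altDiff, coboundary_eq_altDiff, altDiff_altDiff]
  have h1 : ∀ z ∈ cocycles ρ (m + 1), P z ∈ polCocycles ρ S N (m + 1) := by
    refine fun z hz => ⟨hP z hz.1, ?_⟩
    have h := hdd (Q z)
    rw [hPQ z hz, map_sub, LinearMap.mem_ker.1 hz.2, sub_zero] at h
    exact h
  refine ⟨comparison_surjective P h1 h2, fun hM => ?_⟩
  refine comparison_isHomeomorph P (continuous_fillOp 𝕜 _) h1 h2 ?_ ?_
  · rintro _ ⟨b, hb, rfl⟩
    have hdb : coboundary Γ 𝕜 V m b ∈ equivariantCochains ρ (m + 1) := by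
      intro γ x
      rw [coboundary_eq_altDiff]
      exact altDiff_translate ρ (hb γ) x
    refine ⟨⟨fillOp 𝕜 X v₀ g m b, ?_, ?_⟩, hP _ hdb⟩
    · refine polEquivariantCochains_mono ?_ (fillOp_mem hS hact hg hD
        (by linarith [hprod m (by omega)]) (hcontrol m (by omega)) hb)
      exact ((prod_Icc_mono ha1 (by omega) le_rfl).trans hN).trans hNM
    · rw [coboundary_eq_altDiff, coboundary_eq_altDiff]
      exact (fillOp_altDiff 𝕜 hact (hchain m (by omega)) b).symm
  · intro z hz
    have hzc := polCocycles_le ρ S N _ hz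
    refine ⟨⟨Q z, ?_, hPQ z hzc⟩, sub_mem (hP z hzc.1) hz.1⟩
    rcases Nat.eq_zero_or_pos m with rfl | hm
    · exact ⟨hQ z hzc.1, equivariantCochains_zero_le (hN0.trans hNM) (hQ z hzc.1)⟩
    · exact polEquivariantCochains_mono (hM hm) (fillHomotopy_mem hS hg (hprod m (by omega)) hN0
        (fun j hj => (hcontrol j (by omega)).mono (prod_Icc_mono ha1 hj (by omega))) hz.1)

end Comparison

/-! ### The choice of exponents -/

section Exponents

variable {ι : Type*} {X : AbstractSimplicialComplex ι}

theorem mul_Nconst_le_alpha (N : ℝ) {m : ℕ} (hm : 1 ≤ m) :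
    (N + 1) * Nconst X m ≤ alpha X N m := by
  match m, hm with
  | 1, _ => simp [Nconst, alpha]
  | m + 2, _ => exact le_max_left _ _

/-- The strict inequalities leave room for exponents slightly above the degrees. -/
theorem exists_exponents {m : ℕ} {N M : ℝ}
    (hpol : ∀ j, 2 ≤ j → j ≤ m + 1 → PolynomiallyBounded (cFV X j)) (hN : Nconst X (m + 1) < N)
    (hM : (N + 1) * Nconst X m < M) :
    ∃ a : ℕ → ℝ, (∀ j, 2 ≤ j → j ≤ m + 1 → HasFillingExponent X j (a j)) ∧
      ∏ j ∈ Finset.Icc 2 (m + 1), a j ≤ N ∧ (N + 1) * ∏ j ∈ Finset.Icc 2 m, a j ≤ M := by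
  have hc : ∀ k, Continuous fun ε : ℝ =>
      ∏ j ∈ Finset.Icc 2 k, (growthDegree (cFV X j) + ε) := fun k => by fun_prop
  have h1 : ∀ᶠ ε in 𝓝 (0 : ℝ), ∏ j ∈ Finset.Icc 2 (m + 1), (growthDegree (cFV X j) + ε) < N :=
    (hc (m + 1)).continuousAt.eventually_lt continuousAt_const (by simpa [Nconst] using hN)
  have h2 : ∀ᶠ ε in 𝓝 (0 : ℝ), (N + 1) * ∏ j ∈ Finset.Icc 2 m, (growthDegree (cFV X j) + ε) < M :=
    (continuous_const.mul (hc m)).continuousAt.eventually_lt continuousAt_const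
      (by simpa [Nconst] using hM)
  obtain ⟨ε, ⟨h1, h2⟩, hε⟩ := (((h1.and h2).filter_mono nhdsWithin_le_nhds).and
    (self_mem_nhdsWithin (s := Set.Ioi (0 : ℝ)))).exists
  refine ⟨fun j => growthDegree (cFV X j) + ε, fun j hj hj' => ?_, h1.le, h2.le⟩
  have hp := hpol j hj hj'
  have hε' : growthDegree (cFV X j) < growthDegree (cFV X j) + ε := lt_add_of_pos_right _ hε
  have hone : 1 ≤ growthDegree (cFV X j) + ε := hp.one_le_growthDegree.trans hε'.le
  exact ⟨hone, (hp.asympLE_of_growthDegree_lt hε').exists_le le_rfl hone⟩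

theorem IsPolynomial.hasFillingExponent {j : ℕ} (h : IsPolynomial (cFV X j)) :
    HasFillingExponent X j (growthDegree (cFV X j)) := by
  have hp : PolynomiallyBounded (cFV X j) := by
    obtain ⟨a, ha, h, -⟩ := h
    exact ⟨a, ha.le, h⟩
  exact ⟨hp.one_le_growthDegree, h.asympLE_growthDegree.exists_le le_rfl hp.one_le_growthDegree⟩

end Exponents

end PolCohomology

end

theorem theoremC {Γ ι 𝕜 V : Type*} [Group Γ]
    (S : Finset Γ) (hS : Subgroup.closure (S : Set Γ) = ⊤)
    [MulAction Γ ι] (X : AbstractSimplicialComplex ι)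
    (hX : ContractibleSpace (Realization X))
    (hact : IsSimplicialAction Γ X) (hfree : IsFreeAction Γ X)
    (d : ℕ) (hd : 1 ≤ d) (hcoc : HasCocompactSkeleton Γ X (d + 1))
    (hpol : ∀ i, 2 ≤ i → i ≤ d + 1 → PolynomiallyBounded (cFV X i))
    [RCLike 𝕜] [NormedAddCommGroup V] [NormedSpace 𝕜 V] [CompleteSpace V]
    (ρ : Γ →* (V ≃ₗᵢ[𝕜] V))
    (k : ℕ) (hk : 1 ≤ k) (hkd : k ≤ d) :
    (∀ N M : ℝ, Nconst X k < N → N ≤ M →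
      Function.Surjective (comparison ρ S M N k) ∧
      Function.Surjective (comparisonRed ρ S M N k)) ∧
    (∀ N M : ℝ, Nconst X k < N → N ≤ M → (2 ≤ k → alpha X N (k - 1) < M) →
      IsHomeomorph (comparison ρ S M N k) ∧
      IsHomeomorph (comparisonRed ρ S M N k)) ∧
    ((∀ j, 2 ≤ j → j ≤ k → IsPolynomial (cFV X j)) →
      (∀ M : ℝ, Nconst X k ≤ M →
        Function.Surjective (comparison ρ S M (Nconst X k) k) ∧
        Function.Surjective (comparisonRed ρ S M (Nconst X k) k)) ∧
      (∀ M : ℝ, Nconst X k ≤ M → (2 ≤ k → M = alpha X (Nconst X k) (k - 1)) →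
        IsHomeomorph (comparison ρ S M (Nconst X k) k) ∧
        IsHomeomorph (comparisonRed ρ S M (Nconst X k) k))) := by
  obtain ⟨m, rfl⟩ : ∃ m, k = m + 1 := ⟨k - 1, by omega⟩
  have hpol' : ∀ j, 2 ≤ j → j ≤ m + 1 → PolynomiallyBounded (cFV X j) :=
    fun j h1 h2 => hpol j h1 (by omega)
  refine ⟨fun N M hN hNM => ?_, fun N M hN hNM hM => ?_, fun hpoly => ?_⟩
  · obtain ⟨a, ha, h1, -⟩ := exists_exponents hpol' hN (lt_add_one _)
    exact (comparison_of_exponents hS hact hfree (by omega) hcoc ha h1 hNM).1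
  · rcases Nat.eq_zero_or_pos m with rfl | hm
    · obtain ⟨a, ha, h1, -⟩ := exists_exponents hpol' hN (lt_add_one _)
      exact (comparison_of_exponents hS hact hfree (by omega) hcoc ha h1 hNM).2 fun h => by omega
    · have hM' : (N + 1) * Nconst X m < M :=
        (mul_Nconst_le_alpha N hm).trans_lt (hM (by omega))
      obtain ⟨a, ha, h1, h2⟩ := exists_exponents hpol' hN hM'
      exact (comparison_of_exponents hS hact hfree (by omega) hcoc ha h1 hNM).2 fun _ => h2
  · have ha : ∀ j, 2 ≤ j → j ≤ m + 1 → HasFillingExponent X j (growthDegree (cFV X j)) :=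
      fun j h1 h2 => (hpoly j h1 h2).hasFillingExponent
    refine ⟨fun M hNM => ?_, fun M hNM hM => ?_⟩
    · exact (comparison_of_exponents hS hact hfree (by omega) hcoc ha le_rfl hNM).1
    · refine (comparison_of_exponents hS hact hfree (by omega) hcoc ha le_rfl hNM).2 fun hm => ?_
      rw [hM (by omega)]
      exact mul_Nconst_le_alpha _ hm
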